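/- **The Join Lemma.** Let $K$ be a finite simplicial complex with vertex set $V$. A map $f:K\to E$ to a $d$-dimensional real vector space that is linear on every simplex (so it is given by the images of the vertices) is in *general position* if any at most $d+1$ vertices of $K$ have affinely independent images. For a finite set $\Sigma$ of unordered pairs of simplices of $K$ put $I(f,\Sigma)=\sum_{\{\sigma,\tau\}\in\Sigma}|f(\sigma)\cap f(\tau)|$. For an integer $m\ge 0$, an *$m$-obstructor cycle* of $K$ is a finite set $\Sigma$ of unordered pairs $\{\sigma,\tau\}$ of disjoint (nonempty) simplices of $K$ with $\dim\sigma+\dim\tau=m$ such that 1. $\Sigma$ is an $m$-cycle over $\mathbb Z_2$ in $\bigcup\{\sigma\times\tau\subset K\times K:\sigma\cap\tau=\emptyset\}/\mathbb Z_2$, where $\mathbb Z_2$ swaps the factors; that is, every $(m-1)$-cell $\{\alpha,\beta\}$ is a face of an even number of the cells in $\Sigma$; 2. for some general position map $f:K\to\mathbb R^m$, linear on simplices, $I(f,\Sigma)$ is odd; 3. for every $m$-simplex $\sigma$ of $K$ the number of vertices $v$ with $\{\sigma,v\}\in\Sigma$ is even. $K$ is an *$m$-obstructor complex* if $\dim K\le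 m$ and $K$ has an $m$-obstructor cycle. Let $K_j$ be an $m_j$-obstructor complex for $j=1,2$. Then the join $K_1*K_2$ is an $(m_1+m_2+2)$-obstructor complex. More precisely, let $\Sigma^j$ be any $m_j$-obstructor cycle of $K_j$, and let $\Sigma$ consist of the pairs $\{\sigma_1*\sigma_2,\tau_1*\tau_2\}$ and $\{\sigma_1*\tau_2,\tau_1*\sigma_2\}$ for $\{\sigma_1,\tau_1\}\in\Sigma^1$ and $\{\sigma_2,\tau_2\}\in\Sigma^2$. Then $\Sigma$ has $2|\Sigma^1||\Sigma^2|$ elements and is an $(m_1+m_2+2)$-obstructor cycle of $K_1*K_2$. Moreover, for all general position maps $f_j:K_j\to\mathbb R^{m_j}$, linear on simplices, with $I_j=I(f_j,\Sigma^j)$: - for every $\varepsilon>0$ there are functions $g_j:K_j\to\mathbb R$, linear on simplices, with $|g_j(v)-1|<\varepsilon$ at every vertex $v$, such that $(f_j,g_j):K_j\to\mathbb R^{m_j}\times\mathbb R$ is in general position for $j=1,2$ and the linear join $$G:K_1*K_2\to\mathbb R^{m_1+1}\times\mathbb R^{m_2+1},\qquad (1-t)x+ty\mapsto\bigl((1-t)(f_1,g_1)(x),\,t\,(f_2,g_2)(y)\bigr)$$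 has finite intersections $G(\sigma)\cap G(\tau)$ for all $\{\sigma,\tau\}\in\Sigma$ and $I(G,\Sigma)=I_1I_2$; - $I(F,\Sigma)\equiv I_1I_2 \pmod 2$ for every general position map $F:K_1*K_2\to\mathbb R^{m_1+m_2+2}$ that is linear on simplices. -/

import Mathlib

/-! Finite simplicial complexes are Mathlib's `AbstractSimplicialComplex V` over a finite vertex
type `V` (every point of `V` is a vertex). -/

namespace Obstructor

/-- The dimension of a simplex (used only for nonempty `σ`). -/
def simplexDim {V : Type*} (σ : Finset V) : ℕ := σ.card - 1

/-- The join `K₁ * K₂`: a nonempty set of vertices is a simplex when each of its two parts is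
a simplex or empty. -/
def join {V₁ V₂ : Type*} (K₁ : AbstractSimplicialComplex V₁) (K₂ : AbstractSimplicialComplex V₂) :
    AbstractSimplicialComplex (V₁ ⊕ V₂) where
  faces := {s | s.Nonempty ∧ (s.toLeft = ∅ ∨ s.toLeft ∈ K₁.faces) ∧
    (s.toRight = ∅ ∨ s.toRight ∈ K₂.faces)}
  isRelLowerSet_faces := by
    intro s hs
    refine ⟨hs.1, fun t hts ht => ⟨ht, ?_, ?_⟩⟩
    · rcases t.toLeft.eq_empty_or_nonempty with h | h
      · exact Or.inl h
      · have hsub : t.toLeft ⊆ s.toLeft := Finset.toLeft_subset_toLeft hts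
        rcases hs.2.1 with h0 | h0
        · rw [h0] at hsub
          exact Or.inl (Finset.subset_empty.mp hsub)
        · exact Or.inr ((K₁.isRelLowerSet_faces h0).2 hsub h)
    · rcases t.toRight.eq_empty_or_nonempty with h | h
      · exact Or.inl h
      · have hsub : t.toRight ⊆ s.toRight := Finset.toRight_subset_toRight hts
        rcases hs.2.2 with h0 | h0
        · rw [h0] at hsub
          exact Or.inl (Finset.subset_empty.mp hsub)
        · exact Or.inr ((K₂.isRelLowerSet_faces h0).2 hsub h)
  singleton_mem := by
    rintro (v | v)
    · refine ⟨Finset.singleton_nonempty _, Or.inr ?_, Or.inl ?_⟩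
      · have : ({Sum.inl v} : Finset (V₁ ⊕ V₂)).toLeft = {v} := by ext x; simp
        rw [this]
        exact K₁.singleton_mem v
      · ext x; simp
    · refine ⟨Finset.singleton_nonempty _, Or.inl ?_, Or.inr ?_⟩
      · ext x; simp
      · have : ({Sum.inr v} : Finset (V₁ ⊕ V₂)).toRight = {v} := by ext x; simp
        rw [this]
        exact K₂.singleton_mem v

/-- The `d`-cells of `⋃ {σ × τ ⊆ K × K | σ ∩ τ = ∅} / ℤ₂`: unordered pairs of disjoint simplices of
`K` with `dim σ + dim τ = d`. -/
def IsCell {V : Type*} (K : AbstractSimplicialComplex V) (d : ℕ) (c : Sym2 (Finset V)) : Prop :=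
  ∃ σ τ : Finset V, c = s(σ, τ) ∧ σ ∈ K.faces ∧ τ ∈ K.faces ∧ Disjoint σ τ ∧
    simplexDim σ + simplexDim τ = d

/-- The cell `e` is a face of the cell `c`. -/
def IsFaceOf {V : Type*} (e c : Sym2 (Finset V)) : Prop :=
  ∃ α β σ τ : Finset V, e = s(α, β) ∧ c = s(σ, τ) ∧ α ⊆ σ ∧ β ⊆ τ

/-- The set `S` of `m`-cells is an `m`-cycle over `ℤ₂`: its cellular boundary mod 2 vanishes, i.e.
every `(m-1)`-cell is a face of an even number of members of `S`. (There are no such cells for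
`m = 0`.) -/
def IsCycle {V : Type*} (K : AbstractSimplicialComplex V) (m : ℕ)
    (S : Finset (Sym2 (Finset V))) : Prop :=
  (∀ c ∈ S, IsCell K m c) ∧
  ∀ d : ℕ, d + 1 = m → ∀ e, IsCell K d e → Even {c | c ∈ S ∧ IsFaceOf e c}.ncard

/-- The vertices are sent to points in general position: any at most `dim E + 1` of
them have affinely independent images. A function `f : V → E` on the vertices stands for the map
`K → E` that extends it linearly over every simplex. -/
def InGeneralPosition {V E : Type*} [AddCommGroup E] [Module ℝ E] (f : V → E) : Prop :=
  ∀ s : Finset V, s.card ≤ Module.finrank ℝ E + 1 → AffineIndependent ℝ (fun v : s => f v)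

/-- The image `f(σ)` of the geometric simplex `σ` under the linear extension of `f`. -/
def simplexImage {V E : Type*} [AddCommGroup E] [Module ℝ E] (f : V → E) (σ : Finset V) : Set E :=
  convexHull ℝ (f '' (σ : Set V))

/-- `|f(σ) ∩ f(τ)|` for an unordered pair `{σ, τ}`. -/
noncomputable def pairCount {V E : Type*} [AddCommGroup E] [Module ℝ E] (f : V → E)
    (c : Sym2 (Finset V)) : ℕ :=
  Sym2.lift ⟨fun σ τ => (simplexImage f σ ∩ simplexImage f τ).ncard,
    fun σ τ => by simp only [Set.inter_comm]⟩ c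

/-- `∑ |f(σ) ∩ f(τ)|` over the unordered pairs `{σ, τ}` in `S`. -/
noncomputable def intersectionCount {V E : Type*} [AddCommGroup E] [Module ℝ E] (f : V → E)
    (S : Finset (Sym2 (Finset V))) : ℕ :=
  ∑ c ∈ S, pairCount f c

/-- The three conditions on a collection `S` of unordered pairs in the definition of an
`m`-obstructor complex. -/
structure IsObstructorCycle {V : Type*} (K : AbstractSimplicialComplex V) (m : ℕ)
    (S : Finset (Sym2 (Finset V))) : Prop where
  isCycle : IsCycle K m S
  odd_count : ∃ f : V → EuclideanSpace ℝ (Fin m),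
    InGeneralPosition f ∧ Odd (intersectionCount f S)
  even_vertices : ∀ σ ∈ K.faces, simplexDim σ = m → Even {v : V | s(σ, {v}) ∈ S}.ncard

/-- `K` is an `m`-obstructor complex. -/
def IsObstructorComplex {V : Type*} [Finite V] (K : AbstractSimplicialComplex V) (m : ℕ) : Prop :=
  (∀ σ ∈ K.faces, simplexDim σ ≤ m) ∧ ∃ S : Finset (Sym2 (Finset V)), IsObstructorCycle K m S

/-- The pairs `{σ₁ * σ₂, τ₁ * τ₂}` and `{σ₁ * τ₂, τ₁ * σ₂}` made from `p = {σ₁, τ₁}` and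
`q = {σ₂, τ₂}`. -/
def joinPairs {V₁ V₂ : Type*} [DecidableEq V₁] [DecidableEq V₂]
    (p : Sym2 (Finset V₁)) (q : Sym2 (Finset V₂)) : Finset (Sym2 (Finset (V₁ ⊕ V₂))) :=
  Sym2.lift₂ ⟨fun σ₁ τ₁ σ₂ τ₂ =>
    {s(σ₁.disjSum σ₂, τ₁.disjSum τ₂), s(σ₁.disjSum τ₂, τ₁.disjSum σ₂)}, by
      intro σ₁ τ₁ σ₂ τ₂
      refine ⟨?_, Finset.pair_comm _ _⟩
      simp only [Sym2.eq_swap (a := τ₁.disjSum σ₂), Sym2.eq_swap (a := τ₁.disjSum τ₂)]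
      exact Finset.pair_comm _ _⟩ p q

/-- All the pairs `joinPairs p q` with `p ∈ S₁` and `q ∈ S₂`. -/
def joinCycle {V₁ V₂ : Type*} [DecidableEq V₁] [DecidableEq V₂]
    (S₁ : Finset (Sym2 (Finset V₁))) (S₂ : Finset (Sym2 (Finset V₂))) :
    Finset (Sym2 (Finset (V₁ ⊕ V₂))) :=
  S₁.biUnion fun p => S₂.biUnion fun q => joinPairs p q

/-- The linear join `K₁ * K₂ → E₁ × E₂`, `(1-t) x + t y ↦ ((1-t) G₁ x, t G₂ y)`, given on the
vertices. -/
def linearJoin {V₁ V₂ E₁ E₂ : Type*} [AddCommGroup E₁] [AddCommGroup E₂]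
    (G₁ : V₁ → E₁) (G₂ : V₂ → E₂) : V₁ ⊕ V₂ → E₁ × E₂ :=
  Sum.elim (fun v => (G₁ v, 0)) (fun w => (0, G₂ w))

/-- The map `(f, g) : K → E × ℝ`. -/
def withHeight {V E : Type*} (f : V → E) (g : V → ℝ) : V → E × ℝ := fun v => (f v, g v)

end Obstructor

open Obstructor

namespace Obstructor

/-! Intersections are read off from signs. If `d + 2` points of a `d`-dimensional space form an
affine circuit, their dependency `a` is unique up to scale, and disjoint `σ`, `τ` that exhaust the
points have images that meet, in one point, exactly when `a` has one strict sign on `σ` and the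
other on `τ` (Radon). Counting intersections thus becomes counting sign patterns.

For the linear join, the linear dependencies of the lifted vertices `(f i, g i)` are, after division
by the heights, the affine dependencies of the rescaled points `f i / g i`; for `g` near `1` they
have the signs of those of `f`. A generic `g` makes the coefficient sums `s₁`, `s₂` of the two
lifted dependencies `l₁`, `l₂` nonzero, so the only affine dependency of the join is `(s₂ l₁, -s₁
l₂)`. Hence, of the two pairs built from `{σ₁, τ₁}` and `{σ₂, τ₂}`, exactly one meets if both
original pairs meet, and none otherwise. This gives `I(G, Σ) = I₁ I₂`
(`pairCount_add_pairCount_eq_mul`, `exists_heights_linearJoin`). The map `G` itself need not be in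
general position, but every pair of `Σ` spans a circuit, so a small perturbation reaches general
position without changing the count.

The parity does not depend on the general position map (`IsCycle.intersectionCount_modEq`). When one
vertex moves along a generic segment, the count of a pair changes parity once for each of its facet
pairs that meet on the way (`even_card_first_zeros`); summed over a cycle these changes cancel,
since each facet lies in an even number of cells.

The cycle condition for `Σ` is a product formula: the number of ordered cofaces of a pair in the
join is the product of the numbers for its two parts (`ncard_orderedCofaces_joinCycle`). A
codimension one pair either has codimension one in one factor, where the number is even, or is too
large in one factor, where it is zero. Condition 3 is what covers parts with an empty member. -/

theorem mem_simplexImage {V E : Type*} [AddCommGroup E] [Module ℝ E] {f : V → E} {σ : Finset V}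
    {x : E} : x ∈ simplexImage f σ ↔
      ∃ w : V → ℝ, (∀ i ∈ σ, 0 ≤ w i) ∧ ∑ i ∈ σ, w i = 1 ∧ ∑ i ∈ σ, w i • f i = x := by
  classical
  constructor
  · intro hx
    refine convexHull_min (t := {x | ∃ w : V → ℝ, (∀ i ∈ σ, 0 ≤ w i) ∧ ∑ i ∈ σ, w i = 1 ∧
      ∑ i ∈ σ, w i • f i = x}) ?_ ?_ hx
    · rintro _ ⟨i, hi, rfl⟩
      have hi' : i ∈ σ := hi
      refine ⟨fun j => if j = i then 1 else 0, fun j _ => by positivity, ?_, ?_⟩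
      · simp [hi']
      · simp [ite_smul, hi']
    · rintro _ ⟨w, hw, hw1, rfl⟩ _ ⟨u, hu, hu1, rfl⟩ a b ha hb hab
      refine ⟨fun i => a * w i + b * u i, fun i hi => ?_, ?_, ?_⟩
      · have := hw i hi
        have := hu i hi
        positivity
      · rw [Finset.sum_add_distrib, ← Finset.mul_sum, ← Finset.mul_sum, hw1, hu1]
        simpa using hab
      · simp only [add_smul, mul_smul, Finset.sum_add_distrib, Finset.smul_sum]
  · rintro ⟨w, hw, hw1, rfl⟩
    rw [← Finset.centerMass_eq_of_sum_1 _ _ hw1]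
    exact Finset.centerMass_mem_convexHull _ hw (by rw [hw1]; exact one_pos)
      fun i hi => Set.mem_image_of_mem _ hi

theorem affineIndependent_finset_iff {V E : Type*} [AddCommGroup E] [Module ℝ E] {f : V → E}
    {s : Finset V} : AffineIndependent ℝ (fun v : s => f v) ↔
      ∀ b : V → ℝ, ∑ i ∈ s, b i = 0 → ∑ i ∈ s, b i • f i = 0 → ∀ i ∈ s, b i = 0 := by
  classical
  rw [affineIndependent_iff]
  constructor
  · intro h b hb hbf i hi
    refine h Finset.univ (fun j => b j) ?_ ?_ ⟨i, hi⟩ (Finset.mem_univ _)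
    · rw [← hb]; exact Finset.sum_coe_sort s b
    · rw [← hbf]; exact Finset.sum_coe_sort s fun j => b j • f j
  · intro h t w hw hwf e he
    let b : V → ℝ := fun v => if hv : v ∈ s then if ⟨v, hv⟩ ∈ t then w ⟨v, hv⟩ else 0 else 0
    have hb : ∀ v : s, b v = if v ∈ t then w v else 0 := fun v => by simp [b]
    have h1 : ∑ i ∈ s, b i = 0 := by
      rw [← Finset.sum_coe_sort s b]
      simp only [hb, Finset.sum_ite_mem, Finset.univ_inter]
      exact hw
    have h2 : ∑ i ∈ s, b i • f i = 0 := by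
      rw [← Finset.sum_coe_sort s fun i => b i • f i]
      simp only [hb, ite_smul, zero_smul, Finset.sum_ite_mem, Finset.univ_inter]
      exact hwf
    have := h b h1 h2 e e.2
    rw [hb, if_pos he] at this
    exact this

theorem sum_ite_mem_ite_mem {V M : Type*} [AddCommMonoid M] [DecidableEq V] {σ τ T : Finset V}
    (hT : σ ∪ τ ⊆ T) (hd : Disjoint σ τ) (F G : V → M) :
    ∑ i ∈ T, (if i ∈ σ then F i else if i ∈ τ then G i else 0) = ∑ i ∈ σ, F i + ∑ i ∈ τ, G i := by
  have h1 : ∑ i ∈ σ, F i = ∑ i ∈ σ, (if i ∈ σ then F i else if i ∈ τ then G i else 0) :=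
    Finset.sum_congr rfl fun i hi => (if_pos hi).symm
  have h2 : ∑ i ∈ τ, G i = ∑ i ∈ τ, (if i ∈ σ then F i else if i ∈ τ then G i else 0) :=
    Finset.sum_congr rfl fun i hi =>
      ((if_neg (Finset.disjoint_right.1 hd hi)).trans (if_pos hi)).symm
  rw [h1, h2, ← Finset.sum_union hd]
  refine (Finset.sum_subset hT fun i _ hi => ?_).symm
  rw [Finset.mem_union, not_or] at hi
  rw [if_neg hi.1, if_neg hi.2]

/-- The affine dependencies of `f` on `T` are exactly the multiples of `a`, and `a ≠ 0` on `T`. -/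
structure SpansDependencies {V E : Type*} [AddCommGroup E] [Module ℝ E] (f : V → E) (T : Finset V)
    (a : V → ℝ) : Prop where
  sum_eq_zero : ∑ i ∈ T, a i = 0
  sum_smul_eq_zero : ∑ i ∈ T, a i • f i = 0
  exists_ne_zero : ∃ i ∈ T, a i ≠ 0
  exists_mul : ∀ b : V → ℝ, ∑ i ∈ T, b i = 0 → ∑ i ∈ T, b i • f i = 0 →
    ∃ c : ℝ, ∀ i ∈ T, b i = c * a i

/-- The images of `T` form an affine circuit, with minimal dependency `a`. -/
structure IsCircuit {V E : Type*} [AddCommGroup E] [Module ℝ E] (f : V → E) (T : Finset V)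
    (a : V → ℝ) : Prop extends SpansDependencies f T a where
  ne_zero : ∀ i ∈ T, a i ≠ 0

/-- The coefficients `a` are positive on `σ` and negative on `τ`. -/
def Alternates {V : Type*} (a : V → ℝ) (σ τ : Finset V) : Prop :=
  (∀ i ∈ σ, 0 < a i) ∧ ∀ i ∈ τ, a i < 0

theorem alternates_congr {V : Type*} {a b : V → ℝ} {σ τ : Finset V}
    (hσ : ∀ i ∈ σ, SignType.sign (a i) = SignType.sign (b i))
    (hτ : ∀ i ∈ τ, SignType.sign (a i) = SignType.sign (b i)) :
    Alternates a σ τ ↔ Alternates b σ τ := by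
  refine and_congr (forall₂_congr fun i hi => ?_) (forall₂_congr fun i hi => ?_)
  · rw [← sign_eq_one_iff, hσ i hi, sign_eq_one_iff]
  · rw [← sign_eq_neg_one_iff, hτ i hi, sign_eq_neg_one_iff]

/-! ### Affine dependencies and intersections of simplices. -/

section Dependencies

variable {V E : Type*} [AddCommGroup E] [Module ℝ E] {f : V → E} {T : Finset V} {a : V → ℝ}

theorem SpansDependencies.neg (h : SpansDependencies f T a) : SpansDependencies f T (-a) where
  sum_eq_zero := by simp [h.sum_eq_zero]
  sum_smul_eq_zero := by simp [h.sum_smul_eq_zero]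
  exists_ne_zero := by simpa using h.exists_ne_zero
  exists_mul b hb hbf := by
    obtain ⟨c, hc⟩ := h.exists_mul b hb hbf
    exact ⟨-c, fun i hi => by simp [hc i hi]⟩

theorem SpansDependencies.congr {g : V → E} {b : V → ℝ} (h : SpansDependencies f T a)
    (hf : ∀ i ∈ T, f i = g i) (hab : ∀ i ∈ T, a i = b i) : SpansDependencies g T b where
  sum_eq_zero := by rw [← h.sum_eq_zero]; exact (Finset.sum_congr rfl hab).symm
  sum_smul_eq_zero := by
    rw [← h.sum_smul_eq_zero]
    exact Finset.sum_congr rfl fun i hi => by rw [hf i hi, hab i hi]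
  exists_ne_zero := by
    obtain ⟨i, hi, hne⟩ := h.exists_ne_zero
    exact ⟨i, hi, by rwa [← hab i hi]⟩
  exists_mul c hc hcf := by
    obtain ⟨d, hd⟩ := h.exists_mul c hc <| by
      rw [← hcf]; exact Finset.sum_congr rfl fun i hi => by rw [hf i hi]
    exact ⟨d, fun i hi => by rw [hd i hi, hab i hi]⟩

theorem SpansDependencies.ne_zero_of_affineIndependent [DecidableEq V]
    (h : SpansDependencies f T a) {i : V} (hi : i ∈ T)
    (hind : AffineIndependent ℝ fun v : (T.erase i : Finset V) => f v) : a i ≠ 0 := by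
  intro h0
  obtain ⟨j, hj, hne⟩ := h.exists_ne_zero
  have hji : j ≠ i := by rintro rfl; exact hne h0
  refine hne (affineIndependent_finset_iff.1 hind a ?_ ?_ j (Finset.mem_erase.2 ⟨hji, hj⟩))
  · rw [Finset.sum_erase _ h0, h.sum_eq_zero]
  · rw [Finset.sum_erase _ (by rw [h0, zero_smul]), h.sum_smul_eq_zero]

/-- Two convex representations of a common point, subtracted from each other, give a dependency: `w`
on `σ`, `-u` on `τ`, zero elsewhere on `T`. -/
theorem SpansDependencies.exists_mul_of_mem [DecidableEq V] (h : SpansDependencies f T a)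
    {σ τ : Finset V} (hT : σ ∪ τ ⊆ T) (hd : Disjoint σ τ) {x : E} {w u : V → ℝ}
    (hw1 : ∑ i ∈ σ, w i = 1) (hwx : ∑ i ∈ σ, w i • f i = x)
    (hu1 : ∑ i ∈ τ, u i = 1) (hux : ∑ i ∈ τ, u i • f i = x) :
    ∃ c : ℝ, (∀ i ∈ σ, w i = c * a i) ∧ (∀ i ∈ τ, u i = -(c * a i)) ∧
      ∀ i ∈ T, i ∉ σ → i ∉ τ → c * a i = 0 := by
  obtain ⟨c, hc⟩ := h.exists_mul
    (fun i => if i ∈ σ then w i else if i ∈ τ then -u i else 0)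
    (by rw [sum_ite_mem_ite_mem hT hd, hw1, Finset.sum_neg_distrib, hu1]; ring)
    (by
      simp only [ite_smul, zero_smul, neg_smul]
      rw [sum_ite_mem_ite_mem hT hd, Finset.sum_neg_distrib, hwx, hux]; abel)
  refine ⟨c, fun i hi => ?_, fun i hi => ?_, fun i hi h1 h2 => ?_⟩
  · simpa [hi] using hc i (hT (Finset.mem_union_left _ hi))
  · have := hc i (hT (Finset.mem_union_right _ hi))
    rw [if_neg (Finset.disjoint_right.1 hd hi), if_pos hi] at this
    rw [← this, neg_neg]
  · simpa [h1, h2] using (hc i hi).symm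

/-- The weights of a common point on `σ` are `c * a`, and their total being `1` determines `c`. -/
theorem SpansDependencies.inter_subsingleton [DecidableEq V] (h : SpansDependencies f T a)
    {σ τ : Finset V} (hT : σ ∪ τ ⊆ T) (hd : Disjoint σ τ) :
    (simplexImage f σ ∩ simplexImage f τ).Subsingleton := by
  rintro x ⟨hx, hx'⟩ y ⟨hy, hy'⟩
  obtain ⟨w, -, hw1, hwx⟩ := mem_simplexImage.1 hx
  obtain ⟨u, -, hu1, hux⟩ := mem_simplexImage.1 hx'
  obtain ⟨w', -, hw1', hwy⟩ := mem_simplexImage.1 hy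
  obtain ⟨u', -, hu1', huy⟩ := mem_simplexImage.1 hy'
  obtain ⟨c, hc, -⟩ := h.exists_mul_of_mem hT hd hw1 hwx hu1 hux
  obtain ⟨c', hc', -⟩ := h.exists_mul_of_mem hT hd hw1' hwy hu1' huy
  rw [Finset.sum_congr rfl hc, ← Finset.mul_sum] at hw1
  rw [Finset.sum_congr rfl hc', ← Finset.mul_sum] at hw1'
  have hs : ∑ i ∈ σ, a i ≠ 0 := by rintro h0; simp [h0] at hw1
  have hcc : c = c' := mul_right_cancel₀ hs (hw1.trans hw1'.symm)
  rw [← hwx, ← hwy]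
  exact Finset.sum_congr rfl fun i hi => by rw [hc i hi, hc' i hi, hcc]

/-- The Radon point: the positive and negative parts of `a`, divided by their common total mass,
represent the same point. -/
theorem SpansDependencies.inter_nonempty_of_signs [DecidableEq V] (h : SpansDependencies f T a)
    {σ τ : Finset V} (hT : σ ∪ τ ⊆ T) (hd : Disjoint σ τ) (hσ : ∀ i ∈ σ, 0 ≤ a i)
    (hτ : ∀ i ∈ τ, a i ≤ 0) (h0 : ∀ i ∈ T, i ∉ σ → i ∉ τ → a i = 0) :
    (simplexImage f σ ∩ simplexImage f τ).Nonempty := by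
  have e1 : ∑ i ∈ σ, a i + ∑ i ∈ τ, a i = 0 := by
    rw [← Finset.sum_union hd, ← h.sum_eq_zero]
    refine Finset.sum_subset hT fun i hi hi' => ?_
    rw [Finset.mem_union, not_or] at hi'
    exact h0 i hi hi'.1 hi'.2
  have e2 : ∑ i ∈ σ, a i • f i + ∑ i ∈ τ, a i • f i = 0 := by
    rw [← Finset.sum_union hd, ← h.sum_smul_eq_zero]
    refine Finset.sum_subset hT fun i hi hi' => ?_
    rw [Finset.mem_union, not_or] at hi'
    rw [h0 i hi hi'.1 hi'.2, zero_smul]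
  have hpos : 0 < ∑ i ∈ σ, a i := by
    refine (Finset.sum_nonneg hσ).lt_of_ne fun hz => ?_
    rw [← hz, zero_add] at e1
    obtain ⟨i, hi, hne⟩ := h.exists_ne_zero
    refine hne ?_
    by_cases h1 : i ∈ σ
    · exact (Finset.sum_eq_zero_iff_of_nonneg hσ).1 hz.symm i h1
    by_cases h2 : i ∈ τ
    · exact (Finset.sum_eq_zero_iff_of_nonpos hτ).1 e1 i h2
    exact h0 i hi h1 h2
  set s := ∑ i ∈ σ, a i with hs
  refine ⟨∑ i ∈ σ, (a i / s) • f i, mem_simplexImage.2 ⟨fun i => a i / s, fun i hi => ?_, ?_, rfl⟩,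
    mem_simplexImage.2 ⟨fun i => -a i / s, fun i hi => ?_, ?_, ?_⟩⟩
  · exact div_nonneg (hσ i hi) hpos.le
  · rw [← Finset.sum_div, ← hs, div_self hpos.ne']
  · exact div_nonneg (neg_nonneg.2 (hτ i hi)) hpos.le
  · rw [← Finset.sum_div, Finset.sum_neg_distrib, div_eq_one_iff_eq hpos.ne']
    linarith
  · simp only [div_eq_inv_mul, mul_smul, neg_smul, ← Finset.smul_sum, Finset.sum_neg_distrib]
    rw [eq_neg_of_add_eq_zero_left e2]

/-- Zero coefficients and a `T` larger than `σ ∪ τ` are allowed so that the criterion also applies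
to facet pairs at the degenerate moments of a motion. -/
theorem SpansDependencies.inter_nonempty_iff [DecidableEq V] (h : SpansDependencies f T a)
    {σ τ : Finset V} (hT : σ ∪ τ ⊆ T) (hd : Disjoint σ τ) :
    (simplexImage f σ ∩ simplexImage f τ).Nonempty ↔
      (∀ i ∈ T, i ∉ σ → i ∉ τ → a i = 0) ∧ (((∀ i ∈ σ, 0 ≤ a i) ∧ ∀ i ∈ τ, a i ≤ 0) ∨
        ((∀ i ∈ σ, a i ≤ 0) ∧ ∀ i ∈ τ, 0 ≤ a i)) := by
  constructor
  · rintro ⟨x, hx, hx'⟩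
    obtain ⟨w, hw, hw1, hwx⟩ := mem_simplexImage.1 hx
    obtain ⟨u, hu, hu1, hux⟩ := mem_simplexImage.1 hx'
    obtain ⟨c, hc, hc', hc0⟩ := h.exists_mul_of_mem hT hd hw1 hwx hu1 hux
    have hcne : c ≠ 0 := by
      rintro rfl
      rw [Finset.sum_congr rfl hc] at hw1
      simp at hw1
    refine ⟨fun i hi h1 h2 => (mul_eq_zero.1 (hc0 i hi h1 h2)).resolve_left hcne, ?_⟩
    rcases hcne.lt_or_gt with hneg | hpos
    · refine Or.inr ⟨fun i hi => ?_, fun i hi => ?_⟩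
      · have := hw i hi
        rw [hc i hi] at this
        exact nonpos_of_mul_nonneg_right this hneg
      · have := hu i hi
        rw [hc' i hi] at this
        nlinarith
    · refine Or.inl ⟨fun i hi => ?_, fun i hi => ?_⟩
      · have := hw i hi
        rw [hc i hi] at this
        exact nonneg_of_mul_nonneg_right this hpos
      · have := hu i hi
        rw [hc' i hi] at this
        nlinarith
  · rintro ⟨h0, ⟨h1, h2⟩ | ⟨h1, h2⟩⟩
    · exact h.inter_nonempty_of_signs hT hd h1 h2 h0
    · exact h.neg.inter_nonempty_of_signs hT hd (fun i hi => by simpa using h1 i hi)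
        (fun i hi => by simpa using h2 i hi) fun i hi h3 h4 => by simpa using h0 i hi h3 h4

theorem pairCount_of_spansDependencies [DecidableEq V] (h : SpansDependencies f T a)
    {σ τ : Finset V} (hT : σ ∪ τ ⊆ T) (hd : Disjoint σ τ)
    [Decidable (simplexImage f σ ∩ simplexImage f τ).Nonempty] :
    pairCount f s(σ, τ) = if (simplexImage f σ ∩ simplexImage f τ).Nonempty then 1 else 0 := by
  change (simplexImage f σ ∩ simplexImage f τ).ncard = _
  have hs := h.inter_subsingleton hT hd
  split_ifs with hne
  · obtain ⟨x, hx⟩ := hne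
    rw [hs.eq_singleton_of_mem hx, Set.ncard_singleton]
  · rw [Set.not_nonempty_iff_eq_empty.1 hne, Set.ncard_empty]

theorem IsCircuit.pairCount_eq [DecidableEq V] (h : IsCircuit f T a) {σ τ : Finset V}
    (hT : σ ∪ τ = T) (hd : Disjoint σ τ) [Decidable (Alternates a σ τ ∨ Alternates a τ σ)] :
    pairCount f s(σ, τ) = if Alternates a σ τ ∨ Alternates a τ σ then 1 else 0 := by
  classical
  rw [pairCount_of_spansDependencies h.toSpansDependencies hT.le hd]
  congr 1
  rw [h.inter_nonempty_iff hT.le hd]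
  refine propext ⟨?_, ?_⟩
  · have hσ : ∀ i ∈ σ, a i ≠ 0 := fun i hi => h.ne_zero i (hT.le (Finset.mem_union_left _ hi))
    have hτ : ∀ i ∈ τ, a i ≠ 0 := fun i hi => h.ne_zero i (hT.le (Finset.mem_union_right _ hi))
    rintro ⟨-, ⟨h1, h2⟩ | ⟨h1, h2⟩⟩
    · exact Or.inl ⟨fun i hi => (h1 i hi).lt_of_ne (hσ i hi).symm,
        fun i hi => (h2 i hi).lt_of_ne (hτ i hi)⟩
    · exact Or.inr ⟨fun i hi => (h2 i hi).lt_of_ne (hτ i hi).symm,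
        fun i hi => (h1 i hi).lt_of_ne (hσ i hi)⟩
  · intro hh
    refine ⟨fun i hi h1 h2 => ?_, ?_⟩
    · rw [← hT, Finset.mem_union] at hi
      tauto
    · rcases hh with ⟨h1, h2⟩ | ⟨h1, h2⟩
      · exact Or.inl ⟨fun i hi => (h1 i hi).le, fun i hi => (h2 i hi).le⟩
      · exact Or.inr ⟨fun i hi => (h2 i hi).le, fun i hi => (h1 i hi).le⟩

theorem pairCount_eq_of_sign_eq {E' : Type*} [AddCommGroup E'] [Module ℝ E'] {f' : V → E'}
    {a' : V → ℝ} [DecidableEq V] (h : IsCircuit f T a) (h' : IsCircuit f' T a')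
    (hs : ∀ i ∈ T, SignType.sign (a' i) = SignType.sign (a i)) {σ τ : Finset V} (hT : σ ∪ τ = T)
    (hd : Disjoint σ τ) : pairCount f' s(σ, τ) = pairCount f s(σ, τ) := by
  classical
  rw [h.pairCount_eq hT hd, h'.pairCount_eq hT hd]
  have hσ : ∀ i ∈ σ, SignType.sign (a' i) = SignType.sign (a i) := fun i hi =>
    hs i (hT.le (Finset.mem_union_left _ hi))
  have hτ : ∀ i ∈ τ, SignType.sign (a' i) = SignType.sign (a i) := fun i hi =>
    hs i (hT.le (Finset.mem_union_right _ hi))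
  simp only [alternates_congr hσ hτ, alternates_congr hτ hσ]

end Dependencies

/-! ### Barycentric coordinates as coefficients of dependencies. -/

section Barycentric

variable {V E : Type*} [DecidableEq V] [AddCommGroup E] [Module ℝ E] [FiniteDimensional ℝ E]
  {f : V → E} {T : Finset V}

/-- With the coefficient at `v` normalised to `-1`, the others are the barycentric coordinates of
the image of `v` in the affine basis of the remaining points. They are affine in that image, which
makes the motion of one vertex tractable. -/
theorem exists_barycentric {v : V} (hv : v ∈ T) (hT : T.card = Module.finrank ℝ E + 2)
    (hind : AffineIndependent ℝ fun i : (T.erase v : Finset V) => f i) :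
    ∃ c : V → E →ᵃ[ℝ] ℝ,
      (∀ x, SpansDependencies (Function.update f v x) T fun i => if i = v then -1 else c i x) ∧
      ∀ i ∈ T.erase v, ∀ j ∈ T.erase v, c i (f j) = if i = j then 1 else 0 := by
  have hcard : Fintype.card (T.erase v : Finset V) = Module.finrank ℝ E + 1 := by
    rw [Fintype.card_coe, Finset.card_erase_of_mem hv, hT]; rfl
  let B : AffineBasis (T.erase v : Finset V) ℝ E :=
    ⟨_, hind, hind.affineSpan_eq_top_iff_card_eq_finrank_add_one.2 hcard⟩
  let c : V → E →ᵃ[ℝ] ℝ := fun i => if h : i ∈ T.erase v then B.coord ⟨i, h⟩ else 0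
  have hc : ∀ i : (T.erase v : Finset V), c i = B.coord i := fun i => dif_pos i.2
  have hsum : ∀ x, ∑ i ∈ T.erase v, c i x = 1 := fun x => by
    rw [← Finset.sum_coe_sort _ fun i => c i x, ← B.sum_coord_apply_eq_one x]
    exact Finset.sum_congr rfl fun i _ => by rw [hc]
  have hlin : ∀ x, ∑ i ∈ T.erase v, c i x • f i = x := fun x => by
    rw [← Finset.sum_coe_sort _ fun i => c i x • f i]
    conv_rhs => rw [← B.linear_combination_coord_eq_self x]
    exact Finset.sum_congr rfl fun i _ => by rw [hc]; rfl
  refine ⟨c, fun x => ⟨?_, ?_, ⟨v, hv, by simp⟩, fun b hb hbf => ⟨-b v, ?_⟩⟩, ?_⟩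
  · rw [← Finset.add_sum_erase _ _ hv, if_pos rfl, ← hsum x, neg_add_eq_zero, hsum]
    rw [← hsum x]
    exact Finset.sum_congr rfl fun i hi => (if_neg (Finset.ne_of_mem_erase hi)).symm
  · rw [← Finset.add_sum_erase _ _ hv, if_pos rfl, Function.update_self, neg_one_smul,
      neg_add_eq_zero]
    conv_lhs => rw [← hlin x]
    refine Finset.sum_congr rfl fun i hi => ?_
    rw [if_neg (Finset.ne_of_mem_erase hi), Function.update_of_ne (Finset.ne_of_mem_erase hi)]
  · rw [← Finset.add_sum_erase _ _ hv] at hb hbf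
    rw [Function.update_self] at hbf
    have h1 : ∑ i ∈ T.erase v, (b i + b v * c i x) = 0 := by
      rw [Finset.sum_add_distrib, ← Finset.mul_sum, hsum]
      linarith
    have h2 : ∑ i ∈ T.erase v, (b i + b v * c i x) • f i = 0 := by
      simp only [add_smul, mul_smul]
      rw [Finset.sum_add_distrib, ← Finset.smul_sum, hlin, ← hbf, add_comm]
      congr 1
      exact Finset.sum_congr rfl fun i hi => by
        rw [Function.update_of_ne (Finset.ne_of_mem_erase hi)]
    intro i hi
    by_cases hiv : i = v
    · simp [hiv]
    · have := affineIndependent_finset_iff.1 hind _ h1 h2 i (Finset.mem_erase.2 ⟨hiv, hi⟩)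
      rw [if_neg hiv]
      linarith
  · intro i hi j hj
    have := B.coord_apply ⟨i, hi⟩ ⟨j, hj⟩
    rw [← hc ⟨i, hi⟩] at this
    simp only [Subtype.mk.injEq] at this
    exact this

theorem exists_isCircuit (hT : T.card = Module.finrank ℝ E + 2)
    (hind : ∀ i ∈ T, AffineIndependent ℝ fun j : (T.erase i : Finset V) => f j) :
    ∃ a, IsCircuit f T a := by
  obtain ⟨v, hv⟩ : T.Nonempty := Finset.card_pos.1 (by omega)
  obtain ⟨c, hc, -⟩ := exists_barycentric hv hT (hind v hv)
  have := hc (f v)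
  rw [Function.update_eq_self] at this
  exact ⟨_, this, fun i hi => this.ne_zero_of_affineIndependent hi (hind i hi)⟩

theorem InGeneralPosition.exists_isCircuit (h : InGeneralPosition f)
    (hT : T.card = Module.finrank ℝ E + 2) : ∃ a, IsCircuit f T a :=
  Obstructor.exists_isCircuit hT fun i hi => h _ (by rw [Finset.card_erase_of_mem hi]; omega)

end Barycentric

/-! ### Signs of a circuit are stable under perturbation. -/

section Stability

open Filter Topology

/-- With the coefficient at one vertex `v` fixed, the others solve a square linear system that
depends continuously on `f` and is invertible at `f₀`. Its solution varies continuously and, being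
nonzero at `f₀`, keeps its signs nearby. -/
theorem IsCircuit.eventually_sign_eq {V E : Type*} [Finite V] [DecidableEq V]
    [NormedAddCommGroup E] [NormedSpace ℝ E] [FiniteDimensional ℝ E]
    {f₀ : V → E} {T : Finset V} {a₀ : V → ℝ} (h : IsCircuit f₀ T a₀)
    (hT : T.card = Module.finrank ℝ E + 2) :
    ∀ᶠ f in 𝓝 f₀, ∃ a, IsCircuit f T a ∧
      ∀ i ∈ T, SignType.sign (a i) = SignType.sign (a₀ i) := by
  have := Fintype.ofFinite V
  obtain ⟨v, hv⟩ : T.Nonempty := Finset.card_pos.1 (by omega)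
  have hav := h.ne_zero v hv
  let A : (V → E) → (↥(T.erase v) → ℝ) →L[ℝ] E × ℝ := fun f =>
    ∑ i : (T.erase v : Finset V),
      (ContinuousLinearMap.proj (R := ℝ) (φ := fun _ => ℝ) i).smulRight (f i, (1 : ℝ))
  have hA : ∀ (f : V → E) (b : V → ℝ), A f (fun i => b i) =
      (∑ i ∈ T.erase v, b i • f i, ∑ i ∈ T.erase v, b i) := by
    intro f b
    rw [← Finset.sum_coe_sort _ b, ← Finset.sum_coe_sort _ fun i => b i • f i]
    simp only [A, sum_apply, ContinuousLinearMap.smulRight_apply,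
      ContinuousLinearMap.proj_apply, Prod.smul_mk, smul_eq_mul, mul_one]
    exact Prod.ext (by simp [Prod.fst_sum]) (by simp [Prod.snd_sum])
  have hAcont : Continuous A := by
    refine continuous_finsetSum _ fun i _ => ?_
    exact (ContinuousLinearMap.smulRightL ℝ _ _ _).continuous.comp (by fun_prop)
  have hinj : Function.Injective (A f₀) := by
    rw [injective_iff_map_eq_zero]
    intro c hc
    let b : V → ℝ := fun i => if hi : i ∈ T.erase v then c ⟨i, hi⟩ else 0
    have hbv : b v = 0 := by simp [b]
    have hbc : (fun i : (T.erase v : Finset V) => b i) = c := by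
      funext i
      exact dif_pos i.2
    rw [← hbc, hA, Prod.mk_eq_zero] at hc
    -- A kernel vector, extended by zero at `v`, is a multiple of `a₀`; since `a₀ v ≠ 0`, the
    -- multiple is zero.
    obtain ⟨d, hd⟩ := h.exists_mul b
      (by rw [← Finset.add_sum_erase _ _ hv, hbv, hc.2, zero_add])
      (by rw [← Finset.add_sum_erase _ _ hv, hbv, hc.1, zero_smul, zero_add])
    have hd0 : d = 0 := by
      have := hd v hv
      rw [hbv] at this
      exact (mul_eq_zero.1 this.symm).resolve_right hav
    rw [← hbc]
    funext i
    simp [hd i (Finset.mem_of_mem_erase i.2), hd0]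
  have hfin : Module.finrank ℝ (↥(T.erase v) → ℝ) = Module.finrank ℝ (E × ℝ) := by
    rw [Module.finrank_fintype_fun_eq_card, Fintype.card_coe, Finset.card_erase_of_mem hv, hT,
      Module.finrank_prod, Module.finrank_self]
    rfl
  let e : (↥(T.erase v) → ℝ) ≃L[ℝ] E × ℝ :=
    (LinearMap.linearEquivOfInjective (A f₀ : _ →ₗ[ℝ] _) hinj hfin).toContinuousLinearEquiv
  have he : ∀ b, e b = A f₀ b := fun b => rfl
  -- Composing with `e.symm` turns `A f` into an endomorphism equal to `1` at `f₀`, so that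
  -- continuity of inversion in a complete normed ring applies.
  let B : (V → E) → (↥(T.erase v) → ℝ) →L[ℝ] (↥(T.erase v) → ℝ) := fun f =>
    (e.symm : E × ℝ →L[ℝ] _).comp (A f)
  have hB : Continuous B := continuous_const.clm_comp hAcont
  have hB0 : B f₀ = 1 := by
    ext1 b
    change e.symm (A f₀ b) = b
    rw [← he, e.symm_apply_apply]
  let c : (V → E) → ↥(T.erase v) → ℝ := fun f =>
    Ring.inverse (B f) (e.symm (f v, 1))
  have hc : ContinuousAt c f₀ := by
    have h1 : ContinuousAt (fun f => Ring.inverse (B f)) f₀ := by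
      refine ContinuousAt.comp (g := Ring.inverse) ?_ hB.continuousAt
      rw [hB0]
      exact NormedRing.inverse_continuousAt (1 : (_ →L[ℝ] _)ˣ)
    refine h1.clm_apply ?_
    exact (e.symm.continuous.comp (by fun_prop)).continuousAt
  have hc0 : ∀ i : (T.erase v : Finset V), -a₀ v * c f₀ i = a₀ i := by
    have : c f₀ = fun i : (T.erase v : Finset V) => -(a₀ v)⁻¹ * a₀ i := by
      change Ring.inverse (B f₀) (e.symm (f₀ v, 1)) = _
      rw [hB0, Ring.inverse_one, one_apply_eq_self, e.symm_apply_eq, he,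
        hA f₀ fun i => -(a₀ v)⁻¹ * a₀ i]
      have h1 := h.sum_eq_zero
      have h2 := h.sum_smul_eq_zero
      rw [← Finset.add_sum_erase _ _ hv] at h1 h2
      simp only [mul_smul, ← Finset.smul_sum, ← Finset.mul_sum]
      rw [eq_neg_of_add_eq_zero_right h1, eq_neg_of_add_eq_zero_right h2]
      simp [hav, smul_smul]
    intro i
    rw [this]
    field_simp
  have hunit : ∀ᶠ f in 𝓝 f₀, IsUnit (B f) := by
    refine hB.continuousAt.eventually (Units.isOpen.mem_nhds ?_)
    rw [hB0]
    exact isUnit_one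
  have hsign : ∀ i : (T.erase v : Finset V), ∀ᶠ f in 𝓝 f₀,
      SignType.sign (-a₀ v * c f i) = SignType.sign (a₀ i) := by
    intro i
    have hcont : ContinuousAt (fun f => -a₀ v * c f i) f₀ :=
      continuousAt_const.mul ((continuous_apply i).continuousAt.comp hc)
    rcases (h.ne_zero i (Finset.mem_of_mem_erase i.2)).lt_or_gt with hlt | hgt
    · filter_upwards [hcont.eventually_lt continuousAt_const ((hc0 i).trans_lt hlt)] with f hf
      rw [sign_neg hf, sign_neg hlt]
    · filter_upwards [continuousAt_const.eventually_lt hcont (hgt.trans_eq (hc0 i).symm)] with f hf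
      rw [sign_pos hf, sign_pos hgt]
  filter_upwards [hunit, eventually_all.2 hsign] with f hf hs
  have hAc : A f (c f) = (f v, 1) := by
    apply e.symm.injective
    change B f (Ring.inverse (B f) _) = _
    rw [← mul_apply_eq_comp, Ring.mul_inverse_cancel _ hf,
      one_apply_eq_self]
  have hAinj : Function.Injective (A f) := by
    intro x y hxy
    have hxy' : B f x = B f y := congrArg e.symm hxy
    have hinv : ∀ z, (Ring.inverse (B f)) (B f z) = z := fun z => by
      rw [← mul_apply_eq_comp, Ring.inverse_mul_cancel _ hf, one_apply_eq_self]
    rw [← hinv x, hxy', hinv]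
  -- The scale is chosen so that the coefficient at `v` stays `a₀ v`.
  let a : V → ℝ := fun i => if hi : i ∈ T.erase v then -a₀ v * c f ⟨i, hi⟩ else a₀ i
  have ha : ∀ i : (T.erase v : Finset V), a i = -a₀ v * c f i := fun i => dif_pos i.2
  have hav' : a v = a₀ v := by simp [a]
  have hsa : ∀ i ∈ T, SignType.sign (a i) = SignType.sign (a₀ i) := by
    intro i hi
    by_cases hiv : i = v
    · rw [hiv, hav']
    · rw [ha ⟨i, Finset.mem_erase.2 ⟨hiv, hi⟩⟩]
      exact hs _
  have hAa := hA f a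
  rw [funext ha, show (fun i => -a₀ v * c f i) = (-a₀ v) • c f from rfl, map_smul, hAc,
    Prod.ext_iff] at hAa
  simp only [Prod.smul_mk, smul_eq_mul, mul_one] at hAa
  refine ⟨a, ⟨⟨?_, ?_, ⟨v, hv, hav'.trans_ne hav⟩, fun b hb hbf => ⟨b v / a₀ v, ?_⟩⟩, ?_⟩, hsa⟩
  · rw [← Finset.add_sum_erase _ _ hv, ← hAa.2, hav', add_neg_cancel]
  · rw [← Finset.add_sum_erase _ _ hv, ← hAa.1, hav', neg_smul, add_neg_cancel]
  · rw [← Finset.add_sum_erase _ _ hv] at hb hbf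
    have h1 : A f (fun i => b i) = A f ((-b v) • c f) := by
      rw [hA, map_smul, hAc, eq_neg_of_add_eq_zero_right hb, eq_neg_of_add_eq_zero_right hbf]
      simp
    have h2 := hAinj h1
    intro i hi
    by_cases hiv : i = v
    · rw [hiv, hav', div_mul_cancel₀ _ hav]
    · have h3 := congrFun h2 ⟨i, Finset.mem_erase.2 ⟨hiv, hi⟩⟩
      rw [ha ⟨i, Finset.mem_erase.2 ⟨hiv, hi⟩⟩]
      simp only [Pi.smul_apply, smul_eq_mul] at h3
      rw [h3]
      field_simp
  · intro i hi h0
    have := hsa i hi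
    rw [h0, sign_zero, eq_comm, sign_eq_zero_iff] at this
    exact h.ne_zero i hi this

end Stability

/-! ### General position is generic. -/

section Generic

open MeasureTheory Filter Topology

variable {E : Type*} [NormedAddCommGroup E] [NormedSpace ℝ E] [FiniteDimensional ℝ E]
  [MeasurableSpace E] [BorelSpace E] {μ : Measure E} [μ.IsAddHaarMeasure]

theorem ae_affineMap_ne_zero (φ : E →ᵃ[ℝ] ℝ) {y : E} (hy : φ y ≠ 0) : ∀ᵐ x ∂μ, φ x ≠ 0 := by
  have h : ((AffineSubspace.mk' (0 : ℝ) ⊥).comap φ : Set E) = {x | ¬ φ x ≠ 0} := by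
    ext x; simp
  rw [ae_iff, ← h]
  refine Measure.addHaar_affineSubspace μ _ fun htop => hy ?_
  have : y ∈ (AffineSubspace.mk' (0 : ℝ) ⊥).comap φ := htop ▸ AffineSubspace.mem_top ℝ E y
  simpa [AffineSubspace.mem_comap] using this

/-- The new point only has to avoid the affine spans of finitely many sets of at most `d` points.
These are proper subspaces, hence null. -/
theorem ae_affineIndependent_update {V : Type*} [DecidableEq V] {f : V → E} {A : Finset V} (v : V)
    (hA : ∀ s ⊆ A, s.card ≤ Module.finrank ℝ E + 1 → AffineIndependent ℝ fun i : s => f i) :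
    ∀ᵐ q ∂μ, ∀ s ⊆ insert v A, s.card ≤ Module.finrank ℝ E + 1 →
      AffineIndependent ℝ fun i : s => Function.update f v q i := by
  have key : ∀ s ∈ (insert v A).powerset, ∀ᵐ q ∂μ, s.card ≤ Module.finrank ℝ E + 1 →
      AffineIndependent ℝ fun i : s => Function.update f v q i := by
    intro s hs
    rw [Finset.mem_powerset] at hs
    by_cases hcard : s.card ≤ Module.finrank ℝ E + 1
    swap
    · exact Eventually.of_forall fun _ h => absurd h hcard
    have hsub : s.erase v ⊆ A := fun i hi =>
      (Finset.mem_insert.1 (hs (Finset.mem_of_mem_erase hi))).resolve_left (Finset.ne_of_mem_erase hi)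
    have hind := hA _ hsub ((Finset.card_erase_le).trans hcard)
    by_cases hv : v ∈ s
    swap
    · refine Eventually.of_forall fun q _ => ?_
      rw [Finset.erase_eq_of_notMem hv] at hind
      convert hind using 2 with i
      exact Function.update_of_ne (fun h => hv (by rw [← h]; exact i.2)) _ _
    have hne : affineSpan ℝ (Set.range fun i : (s.erase v : Finset V) => f i) ≠ ⊤ := by
      rw [Ne, hind.affineSpan_eq_top_iff_card_eq_finrank_add_one, Fintype.card_coe,
        Finset.card_erase_of_mem hv]
      have := Finset.card_pos.2 ⟨v, hv⟩
      omega
    have h0 := Measure.addHaar_affineSubspace μ _ hne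
    filter_upwards [measure_eq_zero_iff_ae_notMem.1 h0] with q hq _
    rw [affineIndependent_finset_iff]
    intro b hb hbf
    rw [← Finset.add_sum_erase _ _ hv] at hb hbf
    rw [Function.update_self, Finset.sum_congr rfl fun i hi => by
      rw [Function.update_of_ne (Finset.ne_of_mem_erase hi)]] at hbf
    have hbv : b v = 0 := by
      by_contra hbv
      refine hq ?_
      have hw : ∑ i : (s.erase v : Finset V), -(b v)⁻¹ * b i = 1 := by
        rw [← Finset.mul_sum, Finset.sum_coe_sort _ b, eq_neg_of_add_eq_zero_right hb]
        field_simp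
      have := affineCombination_mem_affineSpan hw fun i : (s.erase v : Finset V) => f i
      rw [Finset.affineCombination_eq_linear_combination _ _ _ hw] at this
      rw [SetLike.mem_coe]
      convert this using 1
      simp only [mul_smul, ← Finset.smul_sum]
      rw [Finset.sum_coe_sort _ fun i => b i • f i, eq_neg_of_add_eq_zero_right hbf, smul_neg,
        neg_smul, neg_neg, smul_smul, inv_mul_cancel₀ hbv, one_smul]
    rw [hbv, zero_add] at hb
    rw [hbv, zero_smul, zero_add] at hbf
    intro i hi
    by_cases hiv : i = v
    · rw [hiv, hbv]
    · exact affineIndependent_finset_iff.1 hind b hb hbf i (Finset.mem_erase.2 ⟨hiv, hi⟩)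
  filter_upwards [(eventually_all_finset _).2 key] with q hq s hs
  exact hq s (Finset.mem_powerset.2 hs)

theorem InGeneralPosition.ae_update {V : Type*} [Finite V] [DecidableEq V] {f : V → E}
    (hf : InGeneralPosition f) (v : V) :
    ∀ᵐ q ∂μ, InGeneralPosition (Function.update f v q) := by
  have := Fintype.ofFinite V
  filter_upwards [ae_affineIndependent_update (A := Finset.univ) v fun s _ => hf s] with q hq s
  exact hq s ((Finset.subset_univ s).trans (Finset.subset_insert _ _))

/-- The vertices are put right one at a time; a conull set of positions is dense, so each move can
stay inside the given open set. -/
theorem dense_inGeneralPosition {V E : Type*} [Finite V] [NormedAddCommGroup E] [NormedSpace ℝ E]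
    [FiniteDimensional ℝ E] :
    Dense {f : V → E | InGeneralPosition f} := by
  classical
  have := Fintype.ofFinite V
  let _ : MeasurableSpace E := borel E
  have : BorelSpace E := ⟨rfl⟩
  rw [dense_iff_inter_open]
  intro U hU hne
  have key : ∀ A : Finset V, ∃ f ∈ U, ∀ s ⊆ A, s.card ≤ Module.finrank ℝ E + 1 →
      AffineIndependent ℝ fun i : s => f i := by
    intro A
    induction A using Finset.induction_on with
    | empty =>
      obtain ⟨f, hf⟩ := hne
      refine ⟨f, hf, fun s hs _ => ?_⟩
      rw [Finset.subset_empty] at hs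
      subst hs
      rw [affineIndependent_finset_iff]
      simp
    | insert v A _ ih =>
      obtain ⟨f, hfU, hf⟩ := ih
      have hopen : ∀ᶠ q in 𝓝 (f v), Function.update f v q ∈ U := by
        have hcont : Continuous fun q => Function.update f v q :=
          continuous_const.update v continuous_id
        refine hcont.continuousAt.eventually (hU.mem_nhds ?_)
        simpa using hfU
      obtain ⟨q, hqU, hq⟩ := (Measure.dense_of_ae
        (ae_affineIndependent_update (μ := Measure.addHaar) v hf)).inter_nhds_nonempty hopen
      exact ⟨_, hq, hqU⟩
  obtain ⟨f, hfU, hf⟩ := key Finset.univ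
  exact ⟨f, hfU, fun s => hf s (Finset.subset_univ s)⟩

end Generic

/-! ### A parity count for affine functions on an interval. -/

section Parity

open Classical in
/-- For affine functions `p i + t * q i` on `[a, b]` without common zeros, the number of times at
which exactly one vanishes and all the others are positive has the parity of the number of
endpoints at which all of them are positive. -/
theorem even_card_first_zeros {ι : Type*} (p q : ι → ℝ) (F : Finset ι) : ∀ a b : ℝ, a ≤ b →
    (∀ i ∈ F, p i + a * q i ≠ 0) → (∀ i ∈ F, p i + b * q i ≠ 0) →
    (∀ t ∈ Set.Icc a b, ∀ i ∈ F, ∀ j ∈ F, p i + t * q i = 0 → p j + t * q j = 0 → i = j) →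
    Even ((if ∀ i ∈ F, 0 < p i + a * q i then 1 else 0) +
      (if ∀ i ∈ F, 0 < p i + b * q i then 1 else 0) +
      (F.filter fun i => ∃ t ∈ Set.Ioo a b, p i + t * q i = 0 ∧
        ∀ j ∈ F, j ≠ i → 0 < p j + t * q j).card) := by
  induction F using Finset.induction_on with
  | empty => intro a b _ _ _ _; simp
  | insert k F hk ih =>
    intro a b hab ha hb huniq
    have hF : ∀ i ∈ F, i ∈ insert k F := fun i hi => Finset.mem_insert_of_mem hi
    have hkm : k ∈ insert k F := Finset.mem_insert_self k F
    have hne : ∀ i ∈ F, i ≠ k := fun i hi h => hk (h ▸ hi)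
    have huniqF : ∀ t ∈ Set.Icc a b, ∀ i ∈ F, ∀ j ∈ F, p i + t * q i = 0 → p j + t * q j = 0 →
        i = j := fun t ht i hi j hj => huniq t ht i (hF i hi) j (hF j hj)
    have hnz : ∀ s ∈ Set.Icc a b, p k + s * q k = 0 → ∀ i ∈ F, p i + s * q i ≠ 0 :=
      fun s hs hs0 i hi h0 => hne i hi (huniq s hs i (hF i hi) k hkm h0 hs0)
    -- The zero of `k` is unique, so `k` is counted exactly when all the other functions are
    -- positive at it.
    have hkev : ∀ s, p k + s * q k = 0 → q k ≠ 0 → s ∈ Set.Ioo a b →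
        ((∃ t ∈ Set.Ioo a b, p k + t * q k = 0 ∧
          ∀ j ∈ insert k F, j ≠ k → 0 < p j + t * q j) ↔ ∀ i ∈ F, 0 < p i + s * q i) := by
      intro s hs0 hq hs
      constructor
      · rintro ⟨t, -, ht0, htF⟩ i hi
        have : t = s := mul_right_cancel₀ hq (by linarith)
        exact this ▸ htF i (hF i hi) (hne i hi)
      · exact fun h => ⟨s, hs, hs0, fun j hj hjk => h j ((Finset.mem_insert.1 hj).resolve_left hjk)⟩
    rw [Finset.filter_insert]
    simp only [Finset.forall_mem_insert] at ha hb ⊢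
    -- If `k` is negative at both ends, nothing is counted; if positive at both, it plays no role.
    -- If it changes sign at `s`, the induction hypothesis is applied to the part where `k` is
    -- positive: the contribution of the new endpoint `s` there equals the contribution of `k` as a
    -- zero here.
    rcases ha.1.lt_or_gt with hak | hak <;> rcases hb.1.lt_or_gt with hbk | hbk
    · have hneg : ∀ t ∈ Set.Ioo a b, p k + t * q k < 0 := by
        rintro t ⟨h1, h2⟩
        by_contra hcon
        nlinarith
      rw [if_neg fun h => absurd h.1 hak.not_gt, if_neg fun h => absurd h.1 hbk.not_gt, if_neg,
        Finset.filter_eq_empty_iff.2]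
      · simp
      · rintro i hi ⟨t, ht, -, h2, -⟩
        exact absurd (h2 (hne i hi).symm) (hneg t ht).not_gt
      · rintro ⟨t, ht, h0, -⟩
        exact (hneg t ht).ne h0
    · obtain ⟨s, hs, hs0⟩ : ∃ s ∈ Set.Ioo a b, p k + s * q k = 0 := by
        have hq : 0 < q k := by by_contra hcon; nlinarith
        refine ⟨-p k / q k, ⟨?_, ?_⟩, by rw [div_mul_cancel₀ _ hq.ne']; ring⟩
        · rw [lt_div_iff₀ hq]; linarith
        · rw [div_lt_iff₀ hq]; linarith
      have hq : 0 < q k := by by_contra hcon; nlinarith [hs.1]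
      have hsI : s ∈ Set.Icc a b := ⟨hs.1.le, hs.2.le⟩
      have := ih s b hs.2.le (hnz s hsI hs0) hb.2
        fun t ht => huniqF t ⟨hs.1.le.trans ht.1, ht.2⟩
      have hfil : (F.filter fun i => ∃ t ∈ Set.Ioo a b, p i + t * q i = 0 ∧
          ((k ≠ i → 0 < p k + t * q k) ∧ ∀ j ∈ F, j ≠ i → 0 < p j + t * q j)) =
          F.filter fun i => ∃ t ∈ Set.Ioo s b, p i + t * q i = 0 ∧
            ∀ j ∈ F, j ≠ i → 0 < p j + t * q j := by
        refine Finset.filter_congr fun i hi => ⟨?_, ?_⟩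
        · rintro ⟨t, ht, h0, h1, h2⟩
          have := h1 (hne i hi).symm
          exact ⟨t, ⟨by nlinarith, ht.2⟩, h0, h2⟩
        · rintro ⟨t, ht, h0, h2⟩
          exact ⟨t, ⟨hs.1.trans ht.1, ht.2⟩, h0, fun _ => by nlinarith [ht.1], h2⟩
      have hkev' := hkev s hs0 hq.ne' hs
      simp only [Finset.forall_mem_insert] at hkev'
      rw [if_neg fun h => absurd h.1 hak.not_gt, hfil]
      simp only [hkev', hbk, true_and]
      split_ifs at this ⊢ <;>
        simp_all only [Finset.card_insert_of_notMem, Finset.mem_filter, false_and,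
          not_false_eq_true] <;> grind
    · obtain ⟨s, hs, hs0⟩ : ∃ s ∈ Set.Ioo a b, p k + s * q k = 0 := by
        have hq : q k < 0 := by by_contra hcon; nlinarith
        refine ⟨-p k / q k, ⟨?_, ?_⟩, by rw [div_mul_cancel₀ _ hq.ne]; ring⟩
        · rw [lt_div_iff_of_neg hq]; linarith
        · rw [div_lt_iff_of_neg hq]; linarith
      have hq : q k < 0 := by by_contra hcon; nlinarith [hs.1]
      have hsI : s ∈ Set.Icc a b := ⟨hs.1.le, hs.2.le⟩
      have := ih a s hs.1.le ha.2 (hnz s hsI hs0)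
        fun t ht => huniqF t ⟨ht.1, ht.2.trans hs.2.le⟩
      have hfil : (F.filter fun i => ∃ t ∈ Set.Ioo a b, p i + t * q i = 0 ∧
          ((k ≠ i → 0 < p k + t * q k) ∧ ∀ j ∈ F, j ≠ i → 0 < p j + t * q j)) =
          F.filter fun i => ∃ t ∈ Set.Ioo a s, p i + t * q i = 0 ∧
            ∀ j ∈ F, j ≠ i → 0 < p j + t * q j := by
        refine Finset.filter_congr fun i hi => ⟨?_, ?_⟩
        · rintro ⟨t, ht, h0, h1, h2⟩
          have := h1 (hne i hi).symm
          exact ⟨t, ⟨ht.1, by nlinarith⟩, h0, h2⟩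
        · rintro ⟨t, ht, h0, h2⟩
          exact ⟨t, ⟨ht.1, ht.2.trans hs.2⟩, h0, fun _ => by nlinarith [ht.2], h2⟩
      have hkev' := hkev s hs0 hq.ne hs
      simp only [Finset.forall_mem_insert] at hkev'
      rw [if_neg fun h : 0 < p k + b * q k ∧ _ => absurd h.1 hbk.not_gt, hfil]
      simp only [hkev', hak, true_and]
      split_ifs at this ⊢ <;>
        simp_all only [Finset.card_insert_of_notMem, Finset.mem_filter, false_and,
          not_false_eq_true] <;> grind
    · have hpos : ∀ t ∈ Set.Ioo a b, 0 < p k + t * q k := by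
        rintro t ⟨h1, h2⟩
        by_contra hcon
        nlinarith
      have := ih a b hab ha.2 hb.2 huniqF
      rw [if_neg (c := ∃ t ∈ Set.Ioo a b, _) (by rintro ⟨t, ht, h0, -⟩; exact (hpos t ht).ne' h0)]
      convert this using 3
      · simp only [hak, true_and]
      · simp only [hbk, true_and]
      · refine Finset.filter_congr fun i hi => exists_congr fun t => and_congr_right fun ht => ?_
        simp only [hpos t ht, implies_true, true_and]

end Parity

/-! ### Moving one vertex along a segment. -/

section Moving

open MeasureTheory Filter Topology

theorem simplexImage_congr {V E : Type*} [AddCommGroup E] [Module ℝ E] {f g : V → E}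
    {σ : Finset V} (h : ∀ i ∈ σ, f i = g i) :
    simplexImage f σ = simplexImage g σ := by
  unfold simplexImage
  rw [Set.image_congr h]

/-- At some time, when the vertex `v` moves on the segment from `f v` to `q`, the images of the
two members of `e` meet. -/
def MeetsWhileMoving {V E : Type*} [DecidableEq V] [AddCommGroup E] [Module ℝ E] (f : V → E) (v : V)
    (q : E) (e : Sym2 (Finset V)) : Prop :=
  ∃ t ∈ Set.Ioo (0 : ℝ) 1, ∃ α β : Finset V, e = s(α, β) ∧
    (simplexImage (Function.update f v (AffineMap.lineMap (f v) q t)) α ∩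
      simplexImage (Function.update f v (AffineMap.lineMap (f v) q t)) β).Nonempty

section Algebra

variable {V E : Type*} [DecidableEq V] [AddCommGroup E] [Module ℝ E]

theorem meetsWhileMoving_iff {f : V → E} {v : V} {q : E} {α β : Finset V} :
    MeetsWhileMoving f v q s(α, β) ↔ ∃ t ∈ Set.Ioo (0 : ℝ) 1,
      (simplexImage (Function.update f v (AffineMap.lineMap (f v) q t)) α ∩
        simplexImage (Function.update f v (AffineMap.lineMap (f v) q t)) β).Nonempty := by
  refine exists_congr fun t => and_congr_right fun _ => ⟨?_, fun h => ⟨α, β, rfl, h⟩⟩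
  rintro ⟨α', β', he, h⟩
  rcases Sym2.eq_iff.1 he with ⟨rfl, rfl⟩ | ⟨rfl, rfl⟩
  · exact h
  · rwa [Set.inter_comm]

theorem simplexImage_update_of_notMem {f : V → E} {σ : Finset V} {v : V} (hv : v ∉ σ) (x : E) :
    simplexImage (Function.update f v x) σ = simplexImage f σ :=
  simplexImage_congr fun i hi => Function.update_of_ne (fun h => hv (by rwa [← h])) _ _

open Classical in
-- Neither image changes, and a facet pair never meets, because the omitted vertex has a nonzero
-- coefficient in the circuit.
theorem even_pairCount_add_card_of_notMem [FiniteDimensional ℝ E] {f : V → E} (hf : InGeneralPosition f)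
    {σ τ : Finset V} (hd : Disjoint σ τ) (hcard : σ.card + τ.card = Module.finrank ℝ E + 2) {v : V}
    (hv : v ∉ σ ∪ τ) (q : E) :
    Even (pairCount f s(σ, τ) + pairCount (Function.update f v q) s(σ, τ) +
      ((σ ∪ τ).filter fun i => MeetsWhileMoving f v q s(σ.erase i, τ.erase i)).card) := by
  have hvσ : v ∉ σ := fun h => hv (Finset.mem_union_left _ h)
  have hvτ : v ∉ τ := fun h => hv (Finset.mem_union_right _ h)
  have h1 : pairCount (Function.update f v q) s(σ, τ) = pairCount f s(σ, τ) := by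
    change Set.ncard (_ ∩ _) = Set.ncard (_ ∩ _)
    rw [simplexImage_update_of_notMem hvσ, simplexImage_update_of_notMem hvτ]
  obtain ⟨a, ha⟩ := hf.exists_isCircuit ((Finset.card_union_of_disjoint hd).trans hcard)
  rw [h1, Finset.filter_eq_empty_iff.2, Finset.card_empty, add_zero]
  · exact Even.add_self _
  · intro i hi hmeet
    obtain ⟨t, -, hne⟩ := meetsWhileMoving_iff.1 hmeet
    rw [simplexImage_update_of_notMem (fun h => hvσ (Finset.mem_of_mem_erase h)),
      simplexImage_update_of_notMem (fun h => hvτ (Finset.mem_of_mem_erase h)),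
      ha.inter_nonempty_iff
        (Finset.union_subset_union (Finset.erase_subset _ _) (Finset.erase_subset _ _))
        (hd.mono (Finset.erase_subset _ _) (Finset.erase_subset _ _))] at hne
    exact ha.ne_zero i hi (hne.1 i hi (Finset.notMem_erase _ _) (Finset.notMem_erase _ _))

open Classical in
-- After sign changes the coefficients other than that of `v` become affine functions of time. The
-- pair meets when all are positive; the facet pair omitting `i` meets when the `i`-th vanishes and
-- the others are positive. Hypothesis `hgen` says that no two vanish at the same time, so
-- `even_card_first_zeros` applies.
theorem even_pairCount_add_card_of_mem_right {f : V → E} (hf : InGeneralPosition f)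
    {σ τ : Finset V} (hd : Disjoint σ τ) (hcard : σ.card + τ.card = Module.finrank ℝ E + 2)
    {v : V} (hv : v ∈ τ) {q : E} (hq : InGeneralPosition (Function.update f v q))
    {c : V → E →ᵃ[ℝ] ℝ} (hc : ∀ x, SpansDependencies (Function.update f v x) (σ ∪ τ)
      fun i => if i = v then -1 else c i x)
    (hgen : ∀ i ∈ (σ ∪ τ).erase v, ∀ j ∈ (σ ∪ τ).erase v, i ≠ j →
      c j (f v) * c i q - c i (f v) * c j q ≠ 0) :
    Even (pairCount f s(σ, τ) + pairCount (Function.update f v q) s(σ, τ) +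
      ((σ ∪ τ).filter fun i => MeetsWhileMoving f v q s(σ.erase i, τ.erase i)).card) := by
  have hvσ : v ∉ σ := Finset.disjoint_right.1 hd hv
  have hT : (σ ∪ τ).card = Module.finrank ℝ E + 2 := (Finset.card_union_of_disjoint hd).trans hcard
  have hsub : ∀ i, σ.erase i ∪ τ.erase i ⊆ σ ∪ τ := fun i =>
    Finset.union_subset_union (Finset.erase_subset _ _) (Finset.erase_subset _ _)
  have hdi : ∀ i, Disjoint (σ.erase i) (τ.erase i) := fun i =>
    hd.mono (Finset.erase_subset _ _) (Finset.erase_subset _ _)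
  let ε : V → ℝ := fun i => if i ∈ σ then 1 else -1
  have hε : ∀ i, ε i ≠ 0 := fun i => by simp only [ε]; split_ifs <;> norm_num
  let x : ℝ → E := fun t => AffineMap.lineMap (f v) q t
  have hx0 : x 0 = f v := AffineMap.lineMap_apply_zero _ _
  have hx1 : x 1 = q := AffineMap.lineMap_apply_one _ _
  let p : V → ℝ := fun i => ε i * c i (f v)
  let r : V → ℝ := fun i => ε i * (c i q - c i (f v))
  have hμ : ∀ i t, p i + t * r i = ε i * c i (x t) := by
    intro i t
    simp only [p, r, x]
    rw [AffineMap.apply_lineMap, AffineMap.lineMap_apply_module]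
    simp only [smul_eq_mul]
    ring
  have hnonzero : ∀ y, InGeneralPosition (Function.update f v y) → ∀ i ∈ (σ ∪ τ).erase v,
      c i y ≠ 0 := by
    intro y hy i hi
    have := (hc y).ne_zero_of_affineIndependent (Finset.mem_of_mem_erase hi)
      (hy _ (by rw [Finset.card_erase_of_mem (Finset.mem_of_mem_erase hi)]; omega))
    rwa [if_neg (Finset.ne_of_mem_erase hi)] at this
  have hf' : InGeneralPosition (Function.update f v (f v)) := by rwa [Function.update_eq_self]
  have huniq : ∀ t ∈ Set.Icc (0 : ℝ) 1, ∀ i ∈ (σ ∪ τ).erase v, ∀ j ∈ (σ ∪ τ).erase v,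
      p i + t * r i = 0 → p j + t * r j = 0 → i = j := by
    intro t _ i hi j hj hi0 hj0
    by_contra hij
    have hP : c i (f v) + t * (c i q - c i (f v)) = 0 :=
      (mul_eq_zero.1 (show ε i * _ = 0 by rw [← hi0]; simp only [p, r]; ring)).resolve_left (hε i)
    have hP' : c j (f v) + t * (c j q - c j (f v)) = 0 :=
      (mul_eq_zero.1 (show ε j * _ = 0 by rw [← hj0]; simp only [p, r]; ring)).resolve_left (hε j)
    -- Eliminating the linear terms of two simultaneous zeros leaves `t` times the determinant in
    -- `hgen`; `t = 0` is excluded by general position of `f`.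
    have h0 : t * (c j (f v) * c i q - c i (f v) * c j q) = 0 := by
      linear_combination c j (f v) * hP - c i (f v) * hP'
    rcases mul_eq_zero.1 h0 with ht | h
    · rw [ht, zero_mul, add_zero] at hP
      exact hnonzero _ hf' i hi hP
    · exact hgen i hi j hj hij h
  have hpos : ∀ {i}, i ∈ σ → ∀ t, ε i * c i (x t) = c i (x t) := fun {i} hi t => by
    simp [ε, hi]
  have hneg : ∀ {i}, i ∈ τ → ∀ t, ε i * c i (x t) = -c i (x t) := fun {i} hi t => by
    simp [ε, Finset.disjoint_right.1 hd hi]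
  have hends : ∀ t, (∀ i ∈ (σ ∪ τ).erase v, c i (x t) ≠ 0) →
      ((simplexImage (Function.update f v (x t)) σ ∩
        simplexImage (Function.update f v (x t)) τ).Nonempty ↔
        ∀ i ∈ (σ ∪ τ).erase v, 0 < p i + t * r i) := by
    intro t hnz
    rw [(hc (x t)).inter_nonempty_iff subset_rfl hd]
    constructor
    · rintro ⟨-, ⟨h1, h2⟩ | ⟨-, h2⟩⟩ i hi
      · rw [hμ]
        refine lt_of_le_of_ne ?_ (mul_ne_zero (hε i) (hnz i hi)).symm
        have hiv := Finset.ne_of_mem_erase hi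
        rcases Finset.mem_union.1 (Finset.mem_of_mem_erase hi) with h | h
        · rw [hpos h]
          simpa [hiv] using h1 i h
        · rw [hneg h]
          simpa [hiv] using h2 i h
      -- The coefficient at `v ∈ τ` is `-1`, so only one of the two orientations can occur.
      · have := h2 v hv
        norm_num at this
    · intro h
      refine ⟨fun i hi h1 h2 => ?_, Or.inl ⟨fun i hi => ?_, fun i hi => ?_⟩⟩
      · exact ((Finset.mem_union.1 hi).elim h1 h2).elim
      · have hiv : i ≠ v := fun h => hvσ (h ▸ hi)
        have := h i (Finset.mem_erase.2 ⟨hiv, Finset.mem_union_left _ hi⟩)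
        rw [hμ, hpos hi] at this
        simpa [hiv] using this.le
      · by_cases hiv : i = v
        · simp [hiv]
        · have := h i (Finset.mem_erase.2 ⟨hiv, Finset.mem_union_right _ hi⟩)
          rw [hμ, hneg hi] at this
          simpa [hiv] using this.le
  have hevent : ((σ ∪ τ).filter fun i => MeetsWhileMoving f v q s(σ.erase i, τ.erase i)) =
      ((σ ∪ τ).erase v).filter fun i => ∃ t ∈ Set.Ioo (0 : ℝ) 1, p i + t * r i = 0 ∧
        ∀ j ∈ (σ ∪ τ).erase v, j ≠ i → 0 < p j + t * r j := by
    ext i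
    simp only [Finset.mem_filter, meetsWhileMoving_iff]
    constructor
    · rintro ⟨hi, t, ht, hne⟩
      obtain ⟨h0, hs⟩ := ((hc (x t)).inter_nonempty_iff (hsub i) (hdi i)).1 hne
      have h0i := h0 i hi (Finset.notMem_erase _ _) (Finset.notMem_erase _ _)
      have hiv : i ≠ v := by
        rintro rfl
        norm_num at h0i
      rw [if_neg hiv] at h0i
      have hi' : i ∈ (σ ∪ τ).erase v := Finset.mem_erase.2 ⟨hiv, hi⟩
      have hi0 : p i + t * r i = 0 := by rw [hμ, h0i, mul_zero]
      refine ⟨hi', t, ht, hi0, fun j hj hji => ?_⟩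
      refine lt_of_le_of_ne ?_ fun h =>
        hji (huniq t ⟨ht.1.le, ht.2.le⟩ j hj i hi' h.symm hi0)
      rw [hμ]
      have hjv := Finset.ne_of_mem_erase hj
      rcases hs with ⟨h1, h2⟩ | ⟨-, h2⟩
      · rcases Finset.mem_union.1 (Finset.mem_of_mem_erase hj) with h | h
        · rw [hpos h]
          simpa [hjv] using h1 j (Finset.mem_erase.2 ⟨hji, h⟩)
        · rw [hneg h]
          simpa [hjv] using h2 j (Finset.mem_erase.2 ⟨hji, h⟩)
      · have := h2 v (Finset.mem_erase.2 ⟨hiv.symm, hv⟩)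
        norm_num at this
    · rintro ⟨hi, t, ht, hi0, hj0⟩
      have hiv := Finset.ne_of_mem_erase hi
      refine ⟨Finset.mem_of_mem_erase hi, t, ht,
        ((hc (x t)).inter_nonempty_iff (hsub i) (hdi i)).2 ⟨fun k hk h1 h2 => ?_, Or.inl
          ⟨fun j hj => ?_, fun j hj => ?_⟩⟩⟩
      · have hki : k = i := by
          by_contra hki
          rcases Finset.mem_union.1 hk with h | h
          · exact h1 (Finset.mem_erase.2 ⟨hki, h⟩)
          · exact h2 (Finset.mem_erase.2 ⟨hki, h⟩)
        rw [hki, if_neg hiv]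
        rw [hμ] at hi0
        exact (mul_eq_zero.1 hi0).resolve_left (hε i)
      · obtain ⟨hji, hjσ⟩ := Finset.mem_erase.1 hj
        have hjv : j ≠ v := fun h => hvσ (h ▸ hjσ)
        have := hj0 j (Finset.mem_erase.2 ⟨hjv, Finset.mem_union_left _ hjσ⟩) hji
        rw [hμ, hpos hjσ] at this
        simpa [hjv] using this.le
      · obtain ⟨hji, hjτ⟩ := Finset.mem_erase.1 hj
        by_cases hjv : j = v
        · simp [hjv]
        · have := hj0 j (Finset.mem_erase.2 ⟨hjv, Finset.mem_union_right _ hjτ⟩) hji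
          rw [hμ, hneg hjτ] at this
          simpa [hjv] using this.le
  have hz : ∀ i ∈ (σ ∪ τ).erase v, c i (x 0) ≠ 0 := by rw [hx0]; exact hnonzero _ hf'
  have ho : ∀ i ∈ (σ ∪ τ).erase v, c i (x 1) ≠ 0 := by rw [hx1]; exact hnonzero _ hq
  have h0 := pairCount_of_spansDependencies (hc (x 0)) subset_rfl hd
  have h1 := pairCount_of_spansDependencies (hc (x 1)) subset_rfl hd
  rw [if_congr (hends 0 hz) rfl rfl, hx0, Function.update_eq_self] at h0
  rw [if_congr (hends 1 ho) rfl rfl, hx1] at h1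
  rw [h0, h1, hevent]
  refine even_card_first_zeros p r _ 0 1 zero_le_one (fun i hi => ?_) (fun i hi => ?_) huniq
  · rw [hμ]
    exact mul_ne_zero (hε i) (hz i hi)
  · rw [hμ]
    exact mul_ne_zero (hε i) (ho i hi)

end Algebra

variable {V E : Type*} [DecidableEq V] [NormedAddCommGroup E] [NormedSpace ℝ E]
  [FiniteDimensional ℝ E] [MeasurableSpace E] [BorelSpace E] {μ : Measure E} [μ.IsAddHaarMeasure]

open Classical in
theorem ae_even_pairCount_add_card_of_mem_right [Finite V] {f : V → E} (hf : InGeneralPosition f)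
    {σ τ : Finset V} (hd : Disjoint σ τ) (hcard : σ.card + τ.card = Module.finrank ℝ E + 2)
    {v : V} (hv : v ∈ τ) :
    ∀ᵐ q ∂μ, Even (pairCount f s(σ, τ) + pairCount (Function.update f v q) s(σ, τ) +
      ((σ ∪ τ).filter fun i => MeetsWhileMoving f v q s(σ.erase i, τ.erase i)).card) := by
  have hvT : v ∈ σ ∪ τ := Finset.mem_union_right _ hv
  have hT : (σ ∪ τ).card = Module.finrank ℝ E + 2 := (Finset.card_union_of_disjoint hd).trans hcard
  obtain ⟨c, hc, hcv⟩ := exists_barycentric hvT hT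
    (hf _ (by rw [Finset.card_erase_of_mem hvT]; omega))
  have hnonzero : ∀ i ∈ (σ ∪ τ).erase v, c i (f v) ≠ 0 := by
    intro i hi
    have h := hc (f v)
    rw [Function.update_eq_self] at h
    have := h.ne_zero_of_affineIndependent (Finset.mem_of_mem_erase hi)
      (hf _ (by rw [Finset.card_erase_of_mem (Finset.mem_of_mem_erase hi)]; omega))
    rwa [if_neg (Finset.ne_of_mem_erase hi)] at this
  have hgen : ∀ i ∈ (σ ∪ τ).erase v, ∀ j ∈ (σ ∪ τ).erase v, ∀ᵐ q ∂μ, i ≠ j →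
      c j (f v) * c i q - c i (f v) * c j q ≠ 0 := by
    intro i hi j hj
    by_cases hij : i = j
    · exact Eventually.of_forall fun _ h => absurd hij h
    -- At `f i` this affine function equals `c j (f v)`, which is nonzero.
    have := ae_affineMap_ne_zero (μ := μ) (c j (f v) • c i - c i (f v) • c j) (y := f i) (by
      simpa [hcv i hi i hi, hcv j hj i hi, Ne.symm hij] using hnonzero j hj)
    filter_upwards [this] with q hq _
    simpa using hq
  filter_upwards [hf.ae_update v, (eventually_all_finset _).2 fun i hi =>
    (eventually_all_finset _).2 (hgen i hi)] with q hq hg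
  exact even_pairCount_add_card_of_mem_right hf hd hcard hv hq hc hg

open Classical in
theorem ae_even_pairCount_add_card [Finite V] {f : V → E} (hf : InGeneralPosition f)
    {σ τ : Finset V} (hd : Disjoint σ τ) (hcard : σ.card + τ.card = Module.finrank ℝ E + 2)
    (v : V) :
    ∀ᵐ q ∂μ, Even (pairCount f s(σ, τ) + pairCount (Function.update f v q) s(σ, τ) +
      ((σ ∪ τ).filter fun i => MeetsWhileMoving f v q s(σ.erase i, τ.erase i)).card) := by
  by_cases hv : v ∈ τ
  · exact ae_even_pairCount_add_card_of_mem_right hf hd hcard hv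
  by_cases hv' : v ∈ σ
  · have := ae_even_pairCount_add_card_of_mem_right (μ := μ) hf hd.symm
      (by rwa [add_comm] at hcard) hv'
    simpa only [Sym2.eq_swap (a := τ), Finset.union_comm τ, Sym2.eq_swap (a := τ.erase _)]
      using this
  · exact Eventually.of_forall fun q => even_pairCount_add_card_of_notMem hf hd hcard
      (by simp [hv, hv']) q

end Moving

/-! ### Cells and their facets. -/

section Cells

variable {V : Type*} {K : AbstractSimplicialComplex V} {d m : ℕ} {α β σ τ : Finset V}

theorem isFaceOf_iff : IsFaceOf s(α, β) s(σ, τ) ↔ (α ⊆ σ ∧ β ⊆ τ) ∨ (α ⊆ τ ∧ β ⊆ σ) := by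
  constructor
  · rintro ⟨α', β', σ', τ', he, hc, h1, h2⟩
    rcases Sym2.eq_iff.1 he with ⟨rfl, rfl⟩ | ⟨rfl, rfl⟩ <;>
      rcases Sym2.eq_iff.1 hc with ⟨rfl, rfl⟩ | ⟨rfl, rfl⟩ <;> tauto
  · rintro (⟨h1, h2⟩ | ⟨h1, h2⟩)
    · exact ⟨α, β, σ, τ, rfl, rfl, h1, h2⟩
    · exact ⟨α, β, τ, σ, rfl, Sym2.eq_swap, h1, h2⟩

theorem nonempty_of_mem_faces (h : σ ∈ K.faces) : σ.Nonempty := (K.isRelLowerSet_faces h).1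

theorem mem_faces_of_subset (h : σ ∈ K.faces) (hτ : τ ⊆ σ) (hne : τ.Nonempty) : τ ∈ K.faces :=
  (K.isRelLowerSet_faces h).2 hτ hne

theorem isCell_iff : IsCell K d s(σ, τ) ↔
    σ ∈ K.faces ∧ τ ∈ K.faces ∧ Disjoint σ τ ∧ σ.card + τ.card = d + 2 := by
  have hdim : ∀ {σ τ : Finset V}, σ ∈ K.faces → τ ∈ K.faces →
      (simplexDim σ + simplexDim τ = d ↔ σ.card + τ.card = d + 2) := by
    intro σ τ hσ hτ
    have h1 := (nonempty_of_mem_faces hσ).card_pos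
    have h2 := (nonempty_of_mem_faces hτ).card_pos
    unfold simplexDim
    omega
  constructor
  · rintro ⟨σ', τ', hc, h1, h2, h3, h4⟩
    rw [hdim h1 h2] at h4
    rcases Sym2.eq_iff.1 hc with ⟨rfl, rfl⟩ | ⟨rfl, rfl⟩
    · exact ⟨h1, h2, h3, h4⟩
    · exact ⟨h2, h1, h3.symm, by rw [add_comm, h4]⟩
  · rintro ⟨h1, h2, h3, h4⟩
    exact ⟨σ, τ, rfl, h1, h2, h3, (hdim h1 h2).2 h4⟩

theorem card_erase_add_card_erase [DecidableEq V] {i : V} (hd : Disjoint σ τ) (hi : i ∈ σ ∪ τ) :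
    (σ.erase i).card + (τ.erase i).card + 1 = σ.card + τ.card := by
  rcases Finset.mem_union.1 hi with h | h
  · rw [Finset.erase_eq_of_notMem (Finset.disjoint_left.1 hd h), ← Finset.card_erase_add_one h]
    omega
  · rw [Finset.erase_eq_of_notMem (Finset.disjoint_right.1 hd h), ← Finset.card_erase_add_one h]
    omega

theorem exists_eq_erase [DecidableEq V] (hd : Disjoint σ τ) (hα : α ⊆ σ) (hβ : β ⊆ τ)
    (hcard : α.card + β.card + 1 = σ.card + τ.card) :
    ∃ i ∈ σ ∪ τ, α = σ.erase i ∧ β = τ.erase i := by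
  have h1 := Finset.card_le_card hα
  have h2 := Finset.card_le_card hβ
  rcases Nat.lt_or_ge α.card σ.card with h | h
  · have hβτ : β = τ := Finset.eq_of_subset_of_card_le hβ (by omega)
    obtain ⟨i, hi⟩ := Finset.card_eq_one.1
      (show (σ \ α).card = 1 by rw [Finset.card_sdiff_of_subset hα, hβτ] at *; omega)
    have hiσ : i ∈ σ := (Finset.mem_sdiff.1 (hi.symm ▸ Finset.mem_singleton_self i)).1
    refine ⟨i, Finset.mem_union_left _ hiσ, ?_, ?_⟩
    · rw [← Finset.sdiff_singleton_eq_erase, ← hi, Finset.sdiff_sdiff_eq_self hα]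
    · rw [Finset.erase_eq_of_notMem (Finset.disjoint_left.1 hd hiσ), hβτ]
  · have hασ : α = σ := Finset.eq_of_subset_of_card_le hα h
    obtain ⟨i, hi⟩ := Finset.card_eq_one.1
      (show (τ \ β).card = 1 by rw [Finset.card_sdiff_of_subset hβ, hασ] at *; omega)
    have hiτ : i ∈ τ := (Finset.mem_sdiff.1 (hi.symm ▸ Finset.mem_singleton_self i)).1
    refine ⟨i, Finset.mem_union_right _ hiτ, ?_, ?_⟩
    · rw [Finset.erase_eq_of_notMem (Finset.disjoint_right.1 hd hiτ), hασ]
    · rw [← Finset.sdiff_singleton_eq_erase, ← hi, Finset.sdiff_sdiff_eq_self hβ]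

open Classical in
/-- The facets of a cell, counted by the vertex that they omit. -/
theorem card_filter_erase_eq_card_facets [Fintype V] [DecidableEq V]
    (hc : IsCell K m s(σ, τ)) {P : Sym2 (Finset V) → Prop} (hP : ∀ α β, P s(α, β) → α.Nonempty ∧ β.Nonempty) :
    ((σ ∪ τ).filter fun i => P s(σ.erase i, τ.erase i)).card =
      (Finset.univ.filter fun e => ((∃ d, d + 1 = m ∧ IsCell K d e) ∧ P e) ∧
        IsFaceOf e s(σ, τ)).card := by
  obtain ⟨hσ, hτ, hd, hcard⟩ := isCell_iff.1 hc
  refine Finset.card_bij (fun i _ => s(σ.erase i, τ.erase i)) ?_ ?_ ?_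
  · intro i hi
    obtain ⟨hi, hPi⟩ := Finset.mem_filter.1 hi
    obtain ⟨h1, h2⟩ := hP _ _ hPi
    have hc' := card_erase_add_card_erase hd hi
    have := h1.card_pos
    have := h2.card_pos
    -- Both erased simplices are nonempty, which forces `m ≥ 1`; the subtraction `m - 1` is not
    -- truncated.
    refine Finset.mem_filter.2 ⟨Finset.mem_univ _, ⟨⟨m - 1, by omega, ?_⟩, hPi⟩, ?_⟩
    · exact isCell_iff.2 ⟨mem_faces_of_subset hσ (Finset.erase_subset _ _) h1,
        mem_faces_of_subset hτ (Finset.erase_subset _ _) h2,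
        hd.mono (Finset.erase_subset _ _) (Finset.erase_subset _ _), by omega⟩
    · exact isFaceOf_iff.2 (Or.inl ⟨Finset.erase_subset _ _, Finset.erase_subset _ _⟩)
  · intro i hi j hj hij
    obtain ⟨hi, hPi⟩ := Finset.mem_filter.1 hi
    rcases Sym2.eq_iff.1 hij with ⟨h1, h2⟩ | ⟨h1, -⟩
    · by_contra hne
      rcases Finset.mem_union.1 hi with h | h
      · exact Finset.notMem_erase i σ (h1 ▸ Finset.mem_erase.2 ⟨hne, h⟩)
      · exact Finset.notMem_erase i τ (h2 ▸ Finset.mem_erase.2 ⟨hne, h⟩)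
    -- A match in swapped order would put a vertex in both `σ` and `τ`.
    · obtain ⟨k, hk⟩ := (hP _ _ hPi).1
      have hk' := h1 ▸ hk
      exact (Finset.disjoint_left.1 hd (Finset.mem_of_mem_erase hk)
        (Finset.mem_of_mem_erase hk')).elim
  · intro e he
    obtain ⟨-, ⟨⟨d, hdm, hcell⟩, hPe⟩, hface⟩ := Finset.mem_filter.1 he
    obtain ⟨α, β, rfl, hα, hβ⟩ : ∃ α β, e = s(α, β) ∧ α ⊆ σ ∧ β ⊆ τ := by
      induction e using Sym2.ind with
      | _ α β =>
        rcases isFaceOf_iff.1 hface with ⟨h1, h2⟩ | ⟨h1, h2⟩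
        · exact ⟨α, β, rfl, h1, h2⟩
        · exact ⟨β, α, Sym2.eq_swap, h2, h1⟩
    obtain ⟨-, -, -, hcard'⟩ := isCell_iff.1 hcell
    obtain ⟨i, hi, rfl, rfl⟩ := exists_eq_erase hd hα hβ (by omega)
    exact ⟨i, Finset.mem_filter.2 ⟨hi, hPe⟩, rfl⟩

end Cells

/-! ### The parity of the intersection number of a cycle. -/

section Invariance

open MeasureTheory Filter

variable {V E : Type*} [Finite V] [NormedAddCommGroup E] [NormedSpace ℝ E] [FiniteDimensional ℝ E]
  {K : AbstractSimplicialComplex V} {m : ℕ} {S : Finset (Sym2 (Finset V))}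

/-- The parity changes of the single cells are summed over `S`; double counting regroups the facet
events by facet, and each facet contributes evenly because `S` is a cycle. -/
theorem IsCycle.ae_intersectionCount_update_modEq [DecidableEq V] [MeasurableSpace E]
    [BorelSpace E] {μ : Measure E} [μ.IsAddHaarMeasure] (hS : IsCycle K m S)
    (hm : Module.finrank ℝ E = m) {f : V → E} (hf : InGeneralPosition f) (v : V) :
    ∀ᵐ q ∂μ, intersectionCount (Function.update f v q) S ≡ intersectionCount f S [MOD 2] := by
  classical
  have := Fintype.ofFinite V
  let 𝓔 : E → Finset (Sym2 (Finset V)) := fun q => Finset.univ.filter fun e =>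
    (∃ d, d + 1 = m ∧ IsCell K d e) ∧ MeetsWhileMoving f v q e
  have key : ∀ c ∈ S, ∀ᵐ q ∂μ, Even (pairCount f c + pairCount (Function.update f v q) c +
      ((𝓔 q).filter fun e => IsFaceOf e c).card) := by
    intro c hc
    have hcell := hS.1 c hc
    induction c using Sym2.ind with
    | _ σ τ =>
      obtain ⟨-, -, hd, hcard⟩ := isCell_iff.1 hcell
      filter_upwards [ae_even_pairCount_add_card (μ := μ) hf hd (by rw [hm]; exact hcard) v]
        with q hq
      rw [card_filter_erase_eq_card_facets hcell (P := MeetsWhileMoving f v q)] at hq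
      · rwa [Finset.filter_filter]
      · intro α β h
        obtain ⟨t, -, x, hx, hx'⟩ := meetsWhileMoving_iff.1 h
        constructor
        · by_contra h0
          rw [Finset.not_nonempty_iff_eq_empty.1 h0] at hx
          simp [simplexImage] at hx
        · by_contra h0
          rw [Finset.not_nonempty_iff_eq_empty.1 h0] at hx'
          simp [simplexImage] at hx'
  filter_upwards [(eventually_all_finset _).2 key] with q hq
  have h1 : Even (∑ c ∈ S, (pairCount f c + pairCount (Function.update f v q) c +
      ((𝓔 q).filter fun e => IsFaceOf e c).card)) := Finset.even_sum _ hq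
  have h2 : Even (∑ c ∈ S, ((𝓔 q).filter fun e => IsFaceOf e c).card) := by
    have := Finset.sum_card_bipartiteAbove_eq_sum_card_bipartiteBelow (s := S) (t := 𝓔 q)
      fun c e => IsFaceOf e c
    simp only [Finset.bipartiteAbove, Finset.bipartiteBelow] at this
    rw [this]
    refine Finset.even_sum _ fun e he => ?_
    obtain ⟨-, ⟨d, hd, hcell⟩, -⟩ := Finset.mem_filter.1 he
    have := hS.2 d hd e hcell
    rwa [← Finset.coe_filter, Set.ncard_coe_finset] at this
  rw [Finset.sum_add_distrib, Finset.sum_add_distrib] at h1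
  change (∑ c ∈ S, _) % 2 = (∑ c ∈ S, _) % 2
  rw [Nat.even_iff] at h1 h2
  omega

/-- In both maps the same vertex is moved to one common point `q`, generic for both. After all
vertices have been treated the two maps coincide. -/
theorem IsCycle.intersectionCount_modEq (hS : IsCycle K m S) (hm : Module.finrank ℝ E = m)
    {f g : V → E} (hf : InGeneralPosition f) (hg : InGeneralPosition g) :
    intersectionCount f S ≡ intersectionCount g S [MOD 2] := by
  classical
  have := Fintype.ofFinite V
  let _ : MeasurableSpace E := borel E
  have : BorelSpace E := ⟨rfl⟩
  have key : ∀ A : Finset V, ∃ f' g' : V → E, InGeneralPosition f' ∧ InGeneralPosition g' ∧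
      intersectionCount f' S ≡ intersectionCount f S [MOD 2] ∧
      intersectionCount g' S ≡ intersectionCount g S [MOD 2] ∧ ∀ v ∈ A, f' v = g' v := by
    intro A
    induction A using Finset.induction_on with
    | empty => exact ⟨f, g, hf, hg, rfl, rfl, by simp⟩
    | insert v A _ ih =>
      obtain ⟨f', g', hf', hg', h1, h2, h3⟩ := ih
      obtain ⟨q, ⟨hq1, hq2⟩, hq3, hq4⟩ := (((hf'.ae_update (μ := Measure.addHaar) v).and
        (hg'.ae_update (μ := Measure.addHaar) v)).and
        ((hS.ae_intersectionCount_update_modEq (μ := Measure.addHaar) hm hf' v).and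
        (hS.ae_intersectionCount_update_modEq (μ := Measure.addHaar) hm hg' v))).exists
      refine ⟨_, _, hq1, hq2, hq3.trans h1, hq4.trans h2, fun w hw => ?_⟩
      by_cases hwv : w = v
      · subst hwv
        simp
      · rw [Function.update_of_ne hwv, Function.update_of_ne hwv]
        exact h3 w ((Finset.mem_insert.1 hw).resolve_left hwv)
  obtain ⟨f', g', -, -, h1, h2, h3⟩ := key Finset.univ
  have : f' = g' := funext fun v => h3 v (Finset.mem_univ v)
  exact h1.symm.trans (this ▸ h2)

end Invariance

/-! ### Ordered cofaces, with empty members allowed. -/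

section OrderedCofaces

variable {V : Type*} {K : AbstractSimplicialComplex V} {m : ℕ} {S : Finset (Sym2 (Finset V))}
  {α β : Finset V}

/-- The pairs `(σ, τ)` with `{σ, τ} ∈ S`, `α ⊆ σ` and `β ⊆ τ`. -/
def orderedCofaces (S : Finset (Sym2 (Finset V))) (α β : Finset V) : Set (Finset V × Finset V) :=
  {x | s(x.1, x.2) ∈ S ∧ α ⊆ x.1 ∧ β ⊆ x.2}

/-- As `α` is nonempty and the members of a cell are disjoint, only one ordering of a coface can
contain `α` in its first entry. -/
theorem ncard_cofaces_eq (hS : ∀ c ∈ S, IsCell K m c) (hα : α.Nonempty) :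
    {c | c ∈ S ∧ IsFaceOf s(α, β) c}.ncard = (orderedCofaces S α β).ncard := by
  have himg : {c | c ∈ S ∧ IsFaceOf s(α, β) c} =
      (fun x : Finset V × Finset V => s(x.1, x.2)) '' orderedCofaces S α β := by
    ext c
    induction c using Sym2.ind with
    | _ σ τ =>
      simp only [Set.mem_ofPred_eq, Set.mem_image, isFaceOf_iff]
      constructor
      · rintro ⟨hc, ⟨h1, h2⟩ | ⟨h1, h2⟩⟩
        · exact ⟨(σ, τ), ⟨hc, h1, h2⟩, rfl⟩
        · exact ⟨(τ, σ), ⟨Sym2.eq_swap (a := σ) ▸ hc, h1, h2⟩, Sym2.eq_swap⟩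
      · rintro ⟨⟨σ', τ'⟩, ⟨hc, h1, h2⟩, he⟩
        rcases Sym2.eq_iff.1 he with ⟨rfl, rfl⟩ | ⟨rfl, rfl⟩
        · exact ⟨hc, Or.inl ⟨h1, h2⟩⟩
        · exact ⟨he ▸ hc, Or.inr ⟨h1, h2⟩⟩
  rw [himg, Set.InjOn.ncard_image]
  rintro ⟨σ, τ⟩ ⟨hc, hσ, -⟩ ⟨σ', τ'⟩ ⟨-, hσ', -⟩ he
  rcases Sym2.eq_iff.1 he with ⟨h1, h2⟩ | ⟨-, h2⟩
  · exact Prod.ext h1 h2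
  · obtain ⟨v, hv⟩ := hα
    exact (Finset.disjoint_left.1 (isCell_iff.1 (hS _ hc)).2.2.1 (hσ hv) (h2 ▸ hσ' hv)).elim

theorem ncard_orderedCofaces_comm (S : Finset (Sym2 (Finset V))) (α β : Finset V) :
    (orderedCofaces S α β).ncard = (orderedCofaces S β α).ncard := by
  rw [← Set.ncard_image_of_injective _ Prod.swap_injective]
  congr 1
  ext ⟨σ, τ⟩
  simp only [Set.image_swap_eq_preimage_swap, Set.mem_preimage, orderedCofaces, Set.mem_ofPred_eq,
    Prod.fst_swap, Prod.snd_swap, Sym2.eq_swap (a := τ), and_comm]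

/-- The cardinality `m + 2` of a cell leaves room for just one vertex beside `β`; this turns
condition 3 into a statement about cofaces. -/
theorem ncard_orderedCofaces_empty (hS : ∀ c ∈ S, IsCell K m c) (hβ : β.card = m + 1) :
    (orderedCofaces S ∅ β).ncard = {v : V | s(β, {v}) ∈ S}.ncard := by
  have himg : orderedCofaces S ∅ β = (fun v => ({v}, β)) '' {v : V | s(β, {v}) ∈ S} := by
    ext ⟨σ, τ⟩
    simp only [orderedCofaces, Set.mem_ofPred_eq, Set.mem_image, Prod.mk.injEq,
      Finset.empty_subset, true_and]
    constructor
    · rintro ⟨hc, hβτ⟩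
      obtain ⟨hσ, -, -, hcard⟩ := isCell_iff.1 (hS _ hc)
      have h1 := (nonempty_of_mem_faces hσ).card_pos
      have h2 := Finset.card_le_card hβτ
      obtain rfl := Finset.eq_of_subset_of_card_le hβτ (by omega)
      obtain ⟨v, rfl⟩ := Finset.card_eq_one.1 (show σ.card = 1 by omega)
      exact ⟨v, Sym2.eq_swap (a := ({v} : Finset V)) ▸ hc, rfl, rfl⟩
    · rintro ⟨v, hv, rfl, rfl⟩
      exact ⟨Sym2.eq_swap (b := ({v} : Finset V)) ▸ hv, subset_rfl⟩
  rw [himg, Set.ncard_image_of_injective]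
  intro v w h
  simpa using h

/-- Merges the cycle condition (both members nonempty) with condition 3 (one member empty) into the
form needed for the two parts of a pair in the join. -/
theorem IsObstructorCycle.even_ncard_orderedCofaces (hS : IsObstructorCycle K m S)
    (hα : α = ∅ ∨ α ∈ K.faces) (hβ : β = ∅ ∨ β ∈ K.faces) (hd : Disjoint α β)
    (hcard : α.card + β.card = m + 1) : Even (orderedCofaces S α β).ncard := by
  have hempty : ∀ β : Finset V, β ∈ K.faces → β.card = m + 1 →
      Even (orderedCofaces S ∅ β).ncard := by
    intro β hβ hc
    rw [ncard_orderedCofaces_empty hS.isCycle.1 hc]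
    exact hS.even_vertices β hβ (by simp [simplexDim, hc])
  rcases hα with rfl | hα
  · rcases hβ with rfl | hβ
    · simp at hcard
    · exact hempty β hβ (by simpa using hcard)
  · rcases hβ with rfl | hβ
    · rw [ncard_orderedCofaces_comm]
      exact hempty α hα (by simpa using hcard)
    · rw [← ncard_cofaces_eq hS.isCycle.1 (nonempty_of_mem_faces hα)]
      have h1 := (nonempty_of_mem_faces hα).card_pos
      have h2 := (nonempty_of_mem_faces hβ).card_pos
      exact hS.isCycle.2 (m - 1) (by omega) _ (isCell_iff.2 ⟨hα, hβ, hd, by omega⟩)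

end OrderedCofaces

/-! ### Combinatorics of the join cycle. -/

section Join

variable {V₁ V₂ : Type*} {K₁ : AbstractSimplicialComplex V₁} {K₂ : AbstractSimplicialComplex V₂}
  {m₁ m₂ : ℕ} {S₁ : Finset (Sym2 (Finset V₁))} {S₂ : Finset (Sym2 (Finset V₂))}

theorem disjSum_subset_iff {A B : Finset (V₁ ⊕ V₂)} :
    A ⊆ B ↔ A.toLeft ⊆ B.toLeft ∧ A.toRight ⊆ B.toRight := by
  refine ⟨fun h => ⟨Finset.toLeft_subset_toLeft h, Finset.toRight_subset_toRight h⟩, ?_⟩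
  rintro ⟨h1, h2⟩ (v | v) hv
  · exact Finset.mem_toLeft.1 (h1 (Finset.mem_toLeft.2 hv))
  · exact Finset.mem_toRight.1 (h2 (Finset.mem_toRight.2 hv))

theorem disjoint_iff_toLeft_toRight {A B : Finset (V₁ ⊕ V₂)} :
    Disjoint A B ↔ Disjoint A.toLeft B.toLeft ∧ Disjoint A.toRight B.toRight := by
  simp only [Finset.disjoint_left, Finset.mem_toLeft, Finset.mem_toRight, Sum.forall]

theorem simplexDim_join_le (h₁ : ∀ σ ∈ K₁.faces, simplexDim σ ≤ m₁)
    (h₂ : ∀ σ ∈ K₂.faces, simplexDim σ ≤ m₂) {σ : Finset (V₁ ⊕ V₂)}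
    (hσ : σ ∈ (join K₁ K₂).faces) : simplexDim σ ≤ m₁ + m₂ + 2 := by
  obtain ⟨-, hl, hr⟩ := hσ
  have h1 : σ.toLeft.card ≤ m₁ + 1 := by
    rcases hl with h | h
    · simp [h]
    · have := h₁ _ h
      unfold simplexDim at this
      omega
  have h2 : σ.toRight.card ≤ m₂ + 1 := by
    rcases hr with h | h
    · simp [h]
    · have := h₂ _ h
      unfold simplexDim at this
      omega
  have := σ.card_toLeft_add_card_toRight
  unfold simplexDim
  omega

theorem joinPairs_ne {σ₁ τ₁ : Finset V₁} {σ₂ τ₂ : Finset V₂} (h₁ : σ₁ ≠ τ₁) (h₂ : σ₂ ≠ τ₂) :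
    s(σ₁.disjSum σ₂, τ₁.disjSum τ₂) ≠ s(σ₁.disjSum τ₂, τ₁.disjSum σ₂) := by
  intro h
  rcases Sym2.eq_iff.1 h with ⟨h, -⟩ | ⟨h, -⟩
  · exact h₂ (by simpa using congrArg Finset.toRight h)
  · exact h₁ (by simpa using congrArg Finset.toLeft h)

variable [DecidableEq V₁] [DecidableEq V₂]

theorem joinPairs_mk (σ₁ τ₁ : Finset V₁) (σ₂ τ₂ : Finset V₂) :
    joinPairs s(σ₁, τ₁) s(σ₂, τ₂) =
      {s(σ₁.disjSum σ₂, τ₁.disjSum τ₂), s(σ₁.disjSum τ₂, τ₁.disjSum σ₂)} := rfl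

theorem mem_joinPairs {A B : Finset (V₁ ⊕ V₂)} {p : Sym2 (Finset V₁)} {q : Sym2 (Finset V₂)} :
    s(A, B) ∈ joinPairs p q ↔ p = s(A.toLeft, B.toLeft) ∧ q = s(A.toRight, B.toRight) := by
  induction p using Sym2.ind with
  | _ σ₁ τ₁ =>
  induction q using Sym2.ind with
  | _ σ₂ τ₂ =>
  rw [joinPairs_mk, Finset.mem_insert, Finset.mem_singleton]
  constructor
  · rintro (h | h) <;> rcases Sym2.eq_iff.1 h with ⟨rfl, rfl⟩ | ⟨rfl, rfl⟩ <;> simp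
  · rintro ⟨h1, h2⟩
    rw [← A.toLeft_disjSum_toRight, ← B.toLeft_disjSum_toRight]
    rcases Sym2.eq_iff.1 h1 with ⟨rfl, rfl⟩ | ⟨rfl, rfl⟩ <;>
      rcases Sym2.eq_iff.1 h2 with ⟨rfl, rfl⟩ | ⟨rfl, rfl⟩ <;> simp

theorem mem_joinCycle {A B : Finset (V₁ ⊕ V₂)} : s(A, B) ∈ joinCycle S₁ S₂ ↔
    s(A.toLeft, B.toLeft) ∈ S₁ ∧ s(A.toRight, B.toRight) ∈ S₂ := by
  simp only [joinCycle, Finset.mem_biUnion, mem_joinPairs]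
  constructor
  · rintro ⟨_, hp, _, hq, rfl, rfl⟩
    exact ⟨hp, hq⟩
  · rintro ⟨hp, hq⟩
    exact ⟨_, hp, _, hq, rfl, rfl⟩

theorem sum_joinCycle (F : Sym2 (Finset (V₁ ⊕ V₂)) → ℕ) : ∑ c ∈ joinCycle S₁ S₂, F c =
    ∑ p ∈ S₁, ∑ q ∈ S₂, ∑ c ∈ joinPairs p q, F c := by
  have huniq : ∀ {p p' : Sym2 (Finset V₁)} {q q' : Sym2 (Finset V₂)} {c}, c ∈ joinPairs p q →
      c ∈ joinPairs p' q' → p = p' ∧ q = q' := by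
    intro p p' q q' c h h'
    induction c using Sym2.ind with
    | _ A B =>
      rw [mem_joinPairs] at h h'
      exact ⟨h.1.trans h'.1.symm, h.2.trans h'.2.symm⟩
  unfold joinCycle
  rw [Finset.sum_biUnion]
  · refine Finset.sum_congr rfl fun p _ => Finset.sum_biUnion fun q _ q' _ hne => ?_
    exact Finset.disjoint_left.2 fun c h h' => hne (huniq h h').2
  · intro p _ p' _ hne
    refine Finset.disjoint_left.2 fun c h h' => hne ?_
    obtain ⟨q, -, h⟩ := Finset.mem_biUnion.1 h
    obtain ⟨q', -, h'⟩ := Finset.mem_biUnion.1 h'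
    exact (huniq h h').1

theorem IsCell.ne {V : Type*} {K : AbstractSimplicialComplex V} {m : ℕ} {σ τ : Finset V}
    (h : IsCell K m s(σ, τ)) : σ ≠ τ := by
  rintro rfl
  obtain ⟨h1, -, h2, -⟩ := isCell_iff.1 h
  exact (nonempty_of_mem_faces h1).ne_empty (disjoint_self.1 h2)

theorem sum_joinPairs {σ₁ τ₁ : Finset V₁} {σ₂ τ₂ : Finset V₂} (hp : IsCell K₁ m₁ s(σ₁, τ₁))
    (hq : IsCell K₂ m₂ s(σ₂, τ₂)) (F : Sym2 (Finset (V₁ ⊕ V₂)) → ℕ) : ∑ c ∈ joinPairs s(σ₁, τ₁) s(σ₂, τ₂), F c =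
      F s(σ₁.disjSum σ₂, τ₁.disjSum τ₂) + F s(σ₁.disjSum τ₂, τ₁.disjSum σ₂) := by
  rw [joinPairs_mk, Finset.sum_pair (joinPairs_ne hp.ne hq.ne)]

theorem card_joinCycle (hS₁ : ∀ c ∈ S₁, IsCell K₁ m₁ c) (hS₂ : ∀ c ∈ S₂, IsCell K₂ m₂ c) :
    (joinCycle S₁ S₂).card = 2 * S₁.card * S₂.card := by
  rw [Finset.card_eq_sum_ones, sum_joinCycle]
  have : ∀ p ∈ S₁, ∀ q ∈ S₂, ∑ _c ∈ joinPairs p q, 1 = 2 := by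
    intro p hp q hq
    induction p using Sym2.ind with
    | _ σ₁ τ₁ =>
    induction q using Sym2.ind with
    | _ σ₂ τ₂ => exact sum_joinPairs (hS₁ _ hp) (hS₂ _ hq) fun _ => 1
  rw [Finset.sum_congr rfl fun p hp => Finset.sum_congr rfl (this p hp)]
  simp only [Finset.sum_const, smul_eq_mul]
  ring

theorem isCell_joinCycle (hS₁ : ∀ c ∈ S₁, IsCell K₁ m₁ c) (hS₂ : ∀ c ∈ S₂, IsCell K₂ m₂ c) :
    ∀ c ∈ joinCycle S₁ S₂, IsCell (join K₁ K₂) (m₁ + m₂ + 2) c := by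
  intro c hc
  induction c using Sym2.ind with
  | _ A B =>
    obtain ⟨hl, hr⟩ := mem_joinCycle.1 hc
    obtain ⟨h1, h2, h3, h4⟩ := isCell_iff.1 (hS₁ _ hl)
    obtain ⟨h1', h2', h3', h4'⟩ := isCell_iff.1 (hS₂ _ hr)
    have hA := A.card_toLeft_add_card_toRight
    have hB := B.card_toLeft_add_card_toRight
    have := (nonempty_of_mem_faces h1).card_pos
    have := (nonempty_of_mem_faces h2).card_pos
    exact isCell_iff.2 ⟨⟨Finset.card_pos.1 (by omega), Or.inr h1, Or.inr h1'⟩,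
      ⟨Finset.card_pos.1 (by omega), Or.inr h2, Or.inr h2'⟩,
      disjoint_iff_toLeft_toRight.2 ⟨h3, h3'⟩, by omega⟩

theorem ncard_orderedCofaces_joinCycle (A B : Finset (V₁ ⊕ V₂)) :
    (orderedCofaces (joinCycle S₁ S₂) A B).ncard =
      (orderedCofaces S₁ A.toLeft B.toLeft).ncard *
        (orderedCofaces S₂ A.toRight B.toRight).ncard := by
  have himg : orderedCofaces (joinCycle S₁ S₂) A B =
      (fun x : (Finset V₁ × Finset V₁) × (Finset V₂ × Finset V₂) =>
        (x.1.1.disjSum x.2.1, x.1.2.disjSum x.2.2)) ''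
      (orderedCofaces S₁ A.toLeft B.toLeft ×ˢ orderedCofaces S₂ A.toRight B.toRight) := by
    ext ⟨C, D⟩
    simp only [orderedCofaces, Set.mem_ofPred_eq, Set.mem_image, Set.mem_prod, mem_joinCycle,
      disjSum_subset_iff (A := A), disjSum_subset_iff (A := B)]
    constructor
    · rintro ⟨⟨h1, h2⟩, ⟨h3, h4⟩, h5, h6⟩
      exact ⟨((C.toLeft, D.toLeft), (C.toRight, D.toRight)), ⟨⟨h1, h3, h5⟩, h2, h4, h6⟩,
        Prod.ext C.toLeft_disjSum_toRight D.toLeft_disjSum_toRight⟩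
    · rintro ⟨⟨⟨σ₁, τ₁⟩, σ₂, τ₂⟩, ⟨⟨h1, h3, h5⟩, h2, h4, h6⟩, he⟩
      obtain ⟨rfl, rfl⟩ := Prod.mk.inj he
      simp only [Finset.toLeft_disjSum, Finset.toRight_disjSum]
      exact ⟨⟨h1, h2⟩, ⟨h3, h4⟩, h5, h6⟩
  rw [himg, Set.ncard_image_of_injective, Set.ncard_prod]
  rintro ⟨⟨σ₁, τ₁⟩, σ₂, τ₂⟩ ⟨⟨σ₁', τ₁'⟩, σ₂', τ₂'⟩ h
  obtain ⟨h1, h2⟩ := Prod.mk.inj h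
  have h3 := congrArg Finset.toLeft h1
  have h4 := congrArg Finset.toRight h1
  have h5 := congrArg Finset.toLeft h2
  have h6 := congrArg Finset.toRight h2
  simp only [Finset.toLeft_disjSum, Finset.toRight_disjSum] at h3 h4 h5 h6
  rw [h3, h4, h5, h6]

theorem ncard_orderedCofaces_eq_zero {V : Type*} {K : AbstractSimplicialComplex V} {m : ℕ}
    {S : Finset (Sym2 (Finset V))} (hS : ∀ c ∈ S, IsCell K m c) {α β : Finset V}
    (h : m + 2 < α.card + β.card) : (orderedCofaces S α β).ncard = 0 := by
  have : orderedCofaces S α β = ∅ := by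
    rw [Set.eq_empty_iff_forall_notMem]
    rintro ⟨σ, τ⟩ ⟨hc, h1, h2⟩
    obtain ⟨-, -, -, hcard⟩ := isCell_iff.1 (hS _ hc)
    have := Finset.card_le_card h1
    have := Finset.card_le_card h2
    omega
  rw [this, Set.ncard_empty]

theorem isCycle_joinCycle (hS₁ : IsObstructorCycle K₁ m₁ S₁) (hS₂ : IsObstructorCycle K₂ m₂ S₂) :
    IsCycle (join K₁ K₂) (m₁ + m₂ + 2) (joinCycle S₁ S₂) := by
  have hcell := isCell_joinCycle hS₁.isCycle.1 hS₂.isCycle.1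
  refine ⟨hcell, fun d hd e he => ?_⟩
  induction e using Sym2.ind with
  | _ A B =>
    obtain ⟨hA, hB, hAB, hcard⟩ := isCell_iff.1 he
    rw [ncard_cofaces_eq hcell (nonempty_of_mem_faces hA), ncard_orderedCofaces_joinCycle]
    obtain ⟨hl, hr⟩ := disjoint_iff_toLeft_toRight.1 hAB
    have hA' := A.card_toLeft_add_card_toRight
    have hB' := B.card_toLeft_add_card_toRight
    -- The total cardinality is `m₁ + m₂ + 3`. Either one part has codimension one in its factor,
    -- hence an even number of cofaces, or one part exceeds the size of a cell and has none.
    rcases lt_trichotomy (A.toLeft.card + B.toLeft.card) (m₁ + 1) with h | h | h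
    · rw [ncard_orderedCofaces_eq_zero hS₂.isCycle.1 (by omega), mul_zero]
      exact Even.zero
    · exact (hS₁.even_ncard_orderedCofaces hA.2.1 hB.2.1 hl h).mul_right _
    · rcases Nat.lt_or_ge (m₁ + 2) (A.toLeft.card + B.toLeft.card) with h' | h'
      · rw [ncard_orderedCofaces_eq_zero hS₁.isCycle.1 h', zero_mul]
        exact Even.zero
      · exact (hS₂.even_ncard_orderedCofaces hA.2.2 hB.2.2 hr (by omega)).mul_left _

/-- Every member of a pair in the join cycle has nonempty left and right parts, so a single vertex
never occurs. -/
theorem even_vertices_joinCycle (hS₁ : ∀ c ∈ S₁, IsCell K₁ m₁ c)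
    (hS₂ : ∀ c ∈ S₂, IsCell K₂ m₂ c) (σ : Finset (V₁ ⊕ V₂)) :
    Even {v | s(σ, {v}) ∈ joinCycle S₁ S₂}.ncard := by
  have : {v | s(σ, {v}) ∈ joinCycle S₁ S₂} = ∅ := by
    rw [Set.eq_empty_iff_forall_notMem]
    intro v hv
    obtain ⟨h1, h2⟩ := mem_joinCycle.1 hv
    have h1' := (nonempty_of_mem_faces (isCell_iff.1 (hS₁ _ h1)).2.1).card_pos
    have h2' := (nonempty_of_mem_faces (isCell_iff.1 (hS₂ _ h2)).2.1).card_pos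
    have := Finset.card_toLeft_add_card_toRight (u := {v})
    rw [Finset.card_singleton] at this
    omega
  rw [this, Set.ncard_empty]
  exact Even.zero

end Join

/-! ### Linear circuits and the linear join. -/

/-- The linear dependencies of `h` on `T` are exactly the multiples of `l`, and `l` vanishes nowhere
on `T`. -/
structure IsLinearCircuit {V M : Type*} [AddCommGroup M] [Module ℝ M] (h : V → M) (T : Finset V)
    (l : V → ℝ) : Prop where
  sum_smul_eq_zero : ∑ i ∈ T, l i • h i = 0
  ne_zero : ∀ i ∈ T, l i ≠ 0
  exists_mul : ∀ b : V → ℝ, ∑ i ∈ T, b i • h i = 0 → ∃ c : ℝ, ∀ i ∈ T, b i = c * l i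

theorem sum_smul_withHeight {V E : Type*} [AddCommGroup E] [Module ℝ E] (f : V → E) (g : V → ℝ)
    (T : Finset V) (b : V → ℝ) :
    ∑ i ∈ T, b i • withHeight f g i = (∑ i ∈ T, b i • f i, ∑ i ∈ T, b i * g i) :=
  Prod.ext (by simp [withHeight, Prod.fst_sum]) (by simp [withHeight, Prod.snd_sum])

/-- Since `(f i, g i) = g i • ((g i)⁻¹ • f i, 1)`, linear dependencies of the lifted points are
affine dependencies of the rescaled ones, with coefficients divided by `g`. -/
theorem IsCircuit.isLinearCircuit_withHeight {V E : Type*} [AddCommGroup E] [Module ℝ E]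
    {f : V → E} {g : V → ℝ} {T : Finset V} {a : V → ℝ}
    (h : IsCircuit (fun i => (g i)⁻¹ • f i) T a) (hg : ∀ i, g i ≠ 0) :
    IsLinearCircuit (withHeight f g) T fun i => a i / g i where
  sum_smul_eq_zero := by
    rw [sum_smul_withHeight, Prod.mk_eq_zero, ← h.sum_smul_eq_zero, ← h.sum_eq_zero]
    refine ⟨Finset.sum_congr rfl fun i _ => ?_, Finset.sum_congr rfl fun i _ => ?_⟩
    · rw [smul_smul, div_eq_mul_inv]
    · rw [div_mul_cancel₀ _ (hg i)]
  ne_zero i hi := div_ne_zero (h.ne_zero i hi) (hg i)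
  exists_mul b hb := by
    rw [sum_smul_withHeight, Prod.mk_eq_zero] at hb
    obtain ⟨c, hc⟩ := h.exists_mul (fun i => b i * g i) hb.2 (by
      rw [← hb.1]
      refine Finset.sum_congr rfl fun i _ => ?_
      rw [smul_smul, mul_assoc, mul_inv_cancel₀ (hg i), mul_one])
    refine ⟨c, fun i hi => ?_⟩
    rw [← mul_div_assoc, eq_div_iff (hg i), hc i hi]

/-- Linear dependencies of the join are the pairs `(c₁ l₁, c₂ l₂)`; the affine condition `c₁ ∑ l₁ +
c₂ ∑ l₂ = 0` cuts them down to a line. Both sums must be nonzero, otherwise a coefficient of the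
generator could vanish; constant heights `1` would make them zero. -/
theorem IsLinearCircuit.isCircuit_linearJoin {V₁ V₂ E₁ E₂ : Type*} [AddCommGroup E₁]
    [Module ℝ E₁] [AddCommGroup E₂] [Module ℝ E₂] {h₁ : V₁ → E₁} {h₂ : V₂ → E₂} {T₁ : Finset V₁}
    {T₂ : Finset V₂} {l₁ : V₁ → ℝ} {l₂ : V₂ → ℝ} (H₁ : IsLinearCircuit h₁ T₁ l₁)
    (H₂ : IsLinearCircuit h₂ T₂ l₂) (hne₁ : ∑ i ∈ T₁, l₁ i ≠ 0) (hne₂ : ∑ i ∈ T₂, l₂ i ≠ 0)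
    (hT₁ : T₁.Nonempty) :
    IsCircuit (linearJoin h₁ h₂) (T₁.disjSum T₂)
      (Sum.elim (fun i => (∑ j ∈ T₂, l₂ j) * l₁ i) fun i => -(∑ j ∈ T₁, l₁ j) * l₂ i) := by
  have hsum : ∀ b : V₁ ⊕ V₂ → ℝ, ∑ i ∈ T₁.disjSum T₂, b i • linearJoin h₁ h₂ i =
      (∑ i ∈ T₁, b (Sum.inl i) • h₁ i, ∑ i ∈ T₂, b (Sum.inr i) • h₂ i) := by
    intro b
    rw [Finset.sum_disjSum]
    exact Prod.ext (by simp [linearJoin, Prod.fst_sum]) (by simp [linearJoin, Prod.snd_sum])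
  have hne : ∀ i ∈ T₁.disjSum T₂,
      Sum.elim (fun i => (∑ j ∈ T₂, l₂ j) * l₁ i) (fun i => -(∑ j ∈ T₁, l₁ j) * l₂ i) i ≠ 0 := by
    rintro (i | i) hi
    · exact mul_ne_zero hne₂ (H₁.ne_zero i (Finset.inl_mem_disjSum.1 hi))
    · exact mul_ne_zero (neg_ne_zero.2 hne₁) (H₂.ne_zero i (Finset.inr_mem_disjSum.1 hi))
  refine ⟨⟨?_, ?_, ?_, ?_⟩, hne⟩
  · rw [Finset.sum_disjSum]
    simp only [Sum.elim_inl, Sum.elim_inr, ← Finset.mul_sum]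
    ring
  · rw [hsum]
    simp only [Sum.elim_inl, Sum.elim_inr, mul_smul, ← Finset.smul_sum, H₁.sum_smul_eq_zero,
      H₂.sum_smul_eq_zero, smul_zero, Prod.mk_zero_zero]
  · obtain ⟨i, hi⟩ := hT₁
    exact ⟨Sum.inl i, Finset.inl_mem_disjSum.2 hi, hne _ (Finset.inl_mem_disjSum.2 hi)⟩
  · intro b hb hbj
    rw [hsum, Prod.mk_eq_zero] at hbj
    obtain ⟨c₁, hc₁⟩ := H₁.exists_mul _ hbj.1
    obtain ⟨c₂, hc₂⟩ := H₂.exists_mul _ hbj.2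
    rw [Finset.sum_disjSum, Finset.sum_congr rfl hc₁, Finset.sum_congr rfl hc₂, ← Finset.mul_sum,
      ← Finset.mul_sum] at hb
    refine ⟨c₁ / ∑ j ∈ T₂, l₂ j, ?_⟩
    rintro (i | i) hi
    · rw [hc₁ i (Finset.inl_mem_disjSum.1 hi), Sum.elim_inl, ← mul_assoc, div_mul_cancel₀ _ hne₂]
    · rw [hc₂ i (Finset.inr_mem_disjSum.1 hi), Sum.elim_inr, ← mul_assoc]
      congr 1
      field_simp
      linarith

/-! ### Sign patterns of the join. -/

section Signs

variable {V V₁ V₂ : Type*}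

theorem alternates_elim {a : V₁ → ℝ} {b : V₂ → ℝ} {σ₁ τ₁ : Finset V₁} {σ₂ τ₂ : Finset V₂} :
    Alternates (Sum.elim a b) (σ₁.disjSum σ₂) (τ₁.disjSum τ₂) ↔
      Alternates a σ₁ τ₁ ∧ Alternates b σ₂ τ₂ := by
  simp only [Alternates, Sum.forall, Finset.inl_mem_disjSum, Finset.inr_mem_disjSum, Sum.elim_inl,
    Sum.elim_inr]
  tauto

theorem alternates_mul_of_pos {a : V → ℝ} {x : ℝ} (hx : 0 < x) {σ τ : Finset V} :
    Alternates (fun i => x * a i) σ τ ↔ Alternates a σ τ := by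
  simp [Alternates, mul_neg_iff, hx, hx.not_gt]

theorem alternates_mul_of_neg {a : V → ℝ} {x : ℝ} (hx : x < 0) {σ τ : Finset V} :
    Alternates (fun i => x * a i) σ τ ↔ Alternates a τ σ := by
  simp [Alternates, mul_pos_iff, mul_neg_iff, hx, hx.not_gt, and_comm]

theorem Alternates.not_swap {a : V → ℝ} {σ τ : Finset V} (h : Alternates a σ τ)
    (hσ : σ.Nonempty) : ¬ Alternates a τ σ := by
  obtain ⟨i, hi⟩ := hσ
  exact fun h' => (h.1 i hi).not_gt (h'.2 i hi)

end Signs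

/-- Of the two pairs of joins made from `{σ₁, τ₁}` and `{σ₂, τ₂}`, exactly one has intersecting
images if both `f₁ σ₁` meets `f₁ τ₁` and `f₂ σ₂` meets `f₂ τ₂`, and otherwise none. -/
theorem pairCount_add_pairCount_eq_mul {V₁ V₂ E₁ E₂ E : Type*} [DecidableEq V₁] [DecidableEq V₂]
    [AddCommGroup E₁] [Module ℝ E₁] [AddCommGroup E₂] [Module ℝ E₂] [AddCommGroup E] [Module ℝ E]
    {f₁ : V₁ → E₁} {f₂ : V₂ → E₂} {G : V₁ ⊕ V₂ → E} {σ₁ τ₁ : Finset V₁} {σ₂ τ₂ : Finset V₂}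
    {a₁ l₁ : V₁ → ℝ} {a₂ l₂ : V₂ → ℝ} {x y : ℝ} (hx : x ≠ 0) (hy : y ≠ 0)
    (h₁ : IsCircuit f₁ (σ₁ ∪ τ₁) a₁) (h₂ : IsCircuit f₂ (σ₂ ∪ τ₂) a₂)
    (hG : IsCircuit G ((σ₁ ∪ τ₁).disjSum (σ₂ ∪ τ₂))
      (Sum.elim (fun i => x * l₁ i) fun i => y * l₂ i))
    (hl₁ : ∀ i ∈ σ₁ ∪ τ₁, SignType.sign (l₁ i) = SignType.sign (a₁ i))
    (hl₂ : ∀ i ∈ σ₂ ∪ τ₂, SignType.sign (l₂ i) = SignType.sign (a₂ i))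
    (hd₁ : Disjoint σ₁ τ₁) (hd₂ : Disjoint σ₂ τ₂) (hσ₁ : σ₁.Nonempty) (hσ₂ : σ₂.Nonempty) :
    pairCount G s(σ₁.disjSum σ₂, τ₁.disjSum τ₂) + pairCount G s(σ₁.disjSum τ₂, τ₁.disjSum σ₂) =
      pairCount f₁ s(σ₁, τ₁) * pairCount f₂ s(σ₂, τ₂) := by
  classical
  have hu : ∀ α β : Finset V₂, α ∪ β = σ₂ ∪ τ₂ →
      σ₁.disjSum α ∪ τ₁.disjSum β = (σ₁ ∪ τ₁).disjSum (σ₂ ∪ τ₂) := by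
    intro α β h
    rw [← h]
    ext (i | i) <;> simp
  have hd : ∀ α β : Finset V₂, Disjoint α β → Disjoint (σ₁.disjSum α) (τ₁.disjSum β) := by
    intro α β h
    rw [disjoint_iff_toLeft_toRight]
    simpa using ⟨hd₁, h⟩
  rw [h₁.pairCount_eq rfl hd₁, h₂.pairCount_eq rfl hd₂, hG.pairCount_eq (hu _ _ rfl) (hd _ _ hd₂),
    hG.pairCount_eq (hu _ _ (Finset.union_comm _ _)) (hd _ _ hd₂.symm)]
  have e₁ := alternates_congr (fun i hi => hl₁ i (Finset.mem_union_left τ₁ hi))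
    fun i hi => hl₁ i (Finset.mem_union_right σ₁ hi)
  have e₁' := alternates_congr (fun i hi => hl₁ i (Finset.mem_union_right σ₁ hi))
    fun i hi => hl₁ i (Finset.mem_union_left τ₁ hi)
  have e₂ := alternates_congr (fun i hi => hl₂ i (Finset.mem_union_left τ₂ hi))
    fun i hi => hl₂ i (Finset.mem_union_right σ₂ hi)
  have e₂' := alternates_congr (fun i hi => hl₂ i (Finset.mem_union_right σ₂ hi))
    fun i hi => hl₂ i (Finset.mem_union_left τ₂ hi)
  have n₁ : Alternates a₁ σ₁ τ₁ → ¬ Alternates a₁ τ₁ σ₁ := fun h => h.not_swap hσ₁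
  have n₂ : Alternates a₂ σ₂ τ₂ → ¬ Alternates a₂ τ₂ σ₂ := fun h => h.not_swap hσ₂
  simp only [alternates_elim]
  -- The signs of `x` and `y` decide which of the two joined pairs meets; in every case it is just
  -- one of them.
  rcases hx.lt_or_gt with hx | hx <;> rcases hy.lt_or_gt with hy | hy <;>
    simp only [alternates_mul_of_pos, alternates_mul_of_neg, hx, hy, e₁, e₁', e₂, e₂'] <;>
    by_cases p₁ : Alternates a₁ σ₁ τ₁ <;> by_cases p₂ : Alternates a₂ σ₂ τ₂ <;>
    by_cases q₁ : Alternates a₁ τ₁ σ₁ <;> by_cases q₂ : Alternates a₂ τ₂ σ₂ <;>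
    simp_all

/-! ### Choice of the heights. -/

section Heights

open MeasureTheory Filter Topology

/-- The extra dimension only adds the sets of `d + 2` points; on these `f` has a single dependency
up to scale, and the height coordinate rules it out. -/
theorem inGeneralPosition_withHeight {V E : Type*} [AddCommGroup E] [Module ℝ E]
    [FiniteDimensional ℝ E] {f : V → E} (hf : InGeneralPosition f) {g : V → ℝ}
    (h : ∀ T : Finset V, T.card = Module.finrank ℝ E + 2 →
      ∃ a, IsCircuit f T a ∧ ∑ i ∈ T, a i * g i ≠ 0) :
    InGeneralPosition (withHeight f g) := by
  intro s hs
  rw [Module.finrank_prod, Module.finrank_self] at hs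
  rw [affineIndependent_finset_iff]
  intro b hb hbs
  rw [sum_smul_withHeight, Prod.mk_eq_zero] at hbs
  rcases hs.lt_or_eq with hlt | heq
  · exact affineIndependent_finset_iff.1 (hf s (by omega)) b hb hbs.1
  · obtain ⟨a, ha, hne⟩ := h s heq
    obtain ⟨c, hc⟩ := ha.exists_mul b hb hbs.1
    have : c * ∑ i ∈ s, a i * g i = 0 := by
      rw [← hbs.2, Finset.mul_sum]
      exact Finset.sum_congr rfl fun i hi => by rw [hc i hi, mul_assoc]
    have hc0 := (mul_eq_zero.1 this).resolve_right hne
    intro i hi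
    rw [hc i hi, hc0, zero_mul]

/-- Closeness to `1` and stability of the signs hold on a neighbourhood of the constant heights `1`,
while nonvanishing of `∑ a i * g i` holds for almost every `g`; a conull set meets every
neighbourhood. -/
theorem InGeneralPosition.exists_heights {V E : Type*} [Finite V] [NormedAddCommGroup E]
    [NormedSpace ℝ E] [FiniteDimensional ℝ E] {f : V → E} (hf : InGeneralPosition f) {ε : ℝ}
    (hε : 0 < ε) :
    ∃ g : V → ℝ, (∀ v, |g v - 1| < ε) ∧ InGeneralPosition (withHeight f g) ∧
      ∀ T : Finset V, T.card = Module.finrank ℝ E + 2 → ∃ a l, IsCircuit f T a ∧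
        IsLinearCircuit (withHeight f g) T l ∧ ∑ i ∈ T, l i ≠ 0 ∧
        ∀ i ∈ T, SignType.sign (l i) = SignType.sign (a i) := by
  classical
  have := Fintype.ofFinite V
  have hcirc : ∀ T : Finset V, ∃ a, T.card = Module.finrank ℝ E + 2 → IsCircuit f T a := by
    intro T
    by_cases hT : T.card = Module.finrank ℝ E + 2
    · obtain ⟨a, ha⟩ := hf.exists_isCircuit hT
      exact ⟨a, fun _ => ha⟩
    · exact ⟨0, fun h => absurd h hT⟩
  choose a ha using hcirc
  have hnear : ∀ᶠ g : V → ℝ in 𝓝 1, ∀ v, |g v - 1| < ε ∧ 0 < g v := by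
    refine eventually_all.2 fun v => ?_
    have hcont : ContinuousAt (fun g : V → ℝ => g v) 1 := (continuous_apply v).continuousAt
    refine Eventually.and ?_ (continuousAt_const.eventually_lt hcont one_pos)
    have := (hcont.sub continuousAt_const).abs.eventually_lt (continuousAt_const (y := ε))
      (x₀ := 1) (f := fun g : V → ℝ => |g v - 1|) (by simpa using hε)
    exact this
  have hstable : ∀ᶠ g : V → ℝ in 𝓝 1, ∀ T : Finset V, T.card = Module.finrank ℝ E + 2 →
      ∃ b, IsCircuit (fun i => (g i)⁻¹ • f i) T b ∧
        ∀ i ∈ T, SignType.sign (b i) = SignType.sign (a T i) := by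
    refine eventually_all.2 fun T => ?_
    by_cases hT : T.card = Module.finrank ℝ E + 2
    swap
    · exact Eventually.of_forall fun g h => absurd h hT
    have hcont : Tendsto (fun (g : V → ℝ) i => (g i)⁻¹ • f i) (𝓝 1) (𝓝 f) := by
      rw [tendsto_pi_nhds]
      intro i
      have h1 : Tendsto (fun g : V → ℝ => g i) (𝓝 1) (𝓝 1) :=
        (continuous_apply i).continuousAt
      simpa using (h1.inv₀ one_ne_zero).smul_const (f i)
    filter_upwards [hcont.eventually ((ha T hT).eventually_sign_eq hT)] with g hg _
    exact hg
  have hgen : ∀ᵐ g : V → ℝ, ∀ T : Finset V, T.card = Module.finrank ℝ E + 2 →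
      ∑ i ∈ T, a T i * g i ≠ 0 := by
    refine eventually_all.2 fun T => ?_
    by_cases hT : T.card = Module.finrank ℝ E + 2
    swap
    · exact Eventually.of_forall fun g h => absurd h hT
    obtain ⟨i, hi, hne⟩ := (ha T hT).exists_ne_zero
    let φ : (V → ℝ) →ₗ[ℝ] ℝ := ∑ i ∈ T, a T i • LinearMap.proj i
    have hφ : ∀ g, φ g = ∑ i ∈ T, a T i * g i := fun g => by simp [φ]
    have := ae_affineMap_ne_zero (μ := volume) φ.toAffineMap (y := Pi.single i 1) (by
      simpa [hφ, Pi.single_apply, hi] using hne)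
    filter_upwards [this] with g hg _
    rw [← hφ]
    exact hg
  obtain ⟨g, hg1, hg2, hg3⟩ :=
    (Measure.dense_of_ae hgen).inter_nhds_nonempty (hnear.and hstable)
  have hg0 : ∀ v, g v ≠ 0 := fun v => (hg2 v).2.ne'
  have hgp : InGeneralPosition (withHeight f g) :=
    inGeneralPosition_withHeight hf fun T hT => ⟨a T, ha T hT, hg1 T hT⟩
  refine ⟨g, fun v => (hg2 v).1, hgp, fun T hT => ?_⟩
  obtain ⟨b, hb, hsign⟩ := hg3 T hT
  have hl := hb.isLinearCircuit_withHeight hg0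
  refine ⟨a T, _, ha T hT, hl, fun h0 => ?_, fun i hi => ?_⟩
  · obtain ⟨i, hi⟩ : T.Nonempty := Finset.card_pos.1 (by omega)
    -- If the sum vanished, `l` would be an affine dependency of `d + 2` points in general position
    -- in dimension `d + 1`.
    refine hl.ne_zero i hi (affineIndependent_finset_iff.1 (hgp T ?_) _ h0 hl.sum_smul_eq_zero i hi)
    rw [hT, Module.finrank_prod, Module.finrank_self]
  · rw [← hsign i hi]
    rcases (hb.ne_zero i hi).lt_or_gt with h | h
    · rw [sign_neg h, sign_neg (div_neg_of_neg_of_pos h (hg2 i).2)]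
    · rw [sign_pos h, sign_pos (div_pos h (hg2 i).2)]

end Heights

/-! ### Invariance under linear isomorphisms. -/

section Transport

open Filter Topology

variable {V E E' : Type*} [AddCommGroup E] [Module ℝ E] [AddCommGroup E'] [Module ℝ E']

theorem InGeneralPosition.comp_linearEquiv {f : V → E} (hf : InGeneralPosition f)
    (e : E ≃ₗ[ℝ] E') : InGeneralPosition fun v => e (f v) := by
  intro s hs
  rw [← e.finrank_eq] at hs
  exact (hf s hs).map' e.toLinearMap.toAffineMap e.injective

theorem intersectionCount_comp_linearEquiv (f : V → E) (e : E ≃ₗ[ℝ] E')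
    (S : Finset (Sym2 (Finset V))) :
    intersectionCount (fun v => e (f v)) S = intersectionCount f S := by
  refine Finset.sum_congr rfl fun c _ => ?_
  induction c using Sym2.ind with
  | _ σ τ =>
    have h : ∀ σ : Finset V, simplexImage (fun v => e (f v)) σ = e '' simplexImage f σ := by
      intro σ
      unfold simplexImage
      rw [← LinearEquiv.coe_coe, LinearMap.image_convexHull, Set.image_image]
    change Set.ncard (_ ∩ _) = Set.ncard (_ ∩ _)
    rw [h, h, ← Set.image_inter e.injective, Set.ncard_image_of_injective _ e.injective]

end Transport

/-! ### Perturbation to general position. -/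

section Perturbation

/-- General position is dense, and each pair that spans a circuit keeps its count on a neighbourhood
of `G`. -/
theorem exists_inGeneralPosition_intersectionCount_eq {V E : Type*} [Finite V] [DecidableEq V]
    [NormedAddCommGroup E] [NormedSpace ℝ E] [FiniteDimensional ℝ E] {G : V → E}
    {S : Finset (Sym2 (Finset V))}
    (hS : ∀ σ τ, s(σ, τ) ∈ S → Disjoint σ τ ∧ σ.card + τ.card = Module.finrank ℝ E + 2 ∧
      ∃ a, IsCircuit G (σ ∪ τ) a) :
    ∃ F : V → E, InGeneralPosition F ∧ intersectionCount F S = intersectionCount G S := by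
  have h : ∀ c ∈ S, ∀ᶠ F in nhds G, pairCount F c = pairCount G c := by
    intro c hc
    induction c using Sym2.ind with
    | _ σ τ =>
      obtain ⟨hd, hcard, a, ha⟩ := hS σ τ hc
      filter_upwards [ha.eventually_sign_eq ((Finset.card_union_of_disjoint hd).trans hcard)]
        with F hF
      obtain ⟨b, hb, hs⟩ := hF
      exact pairCount_eq_of_sign_eq ha hb hs rfl hd
  obtain ⟨F, hF, hF'⟩ := dense_inGeneralPosition.inter_nhds_nonempty
    ((Filter.eventually_all_finset _).2 h)
  exact ⟨F, hF, Finset.sum_congr rfl hF'⟩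

end Perturbation

/-! ### Intersection numbers of the join. -/

section Join

variable {V₁ V₂ : Type*} [Finite V₁] [Finite V₂] [DecidableEq V₁] [DecidableEq V₂]
  {E₁ E₂ : Type*} [NormedAddCommGroup E₁] [NormedSpace ℝ E₁] [FiniteDimensional ℝ E₁]
  [NormedAddCommGroup E₂] [NormedSpace ℝ E₂] [FiniteDimensional ℝ E₂]
  {K₁ : AbstractSimplicialComplex V₁} {K₂ : AbstractSimplicialComplex V₂} {m₁ m₂ : ℕ}
  {S₁ : Finset (Sym2 (Finset V₁))} {S₂ : Finset (Sym2 (Finset V₂))}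

theorem exists_heights_linearJoin (hm₁ : Module.finrank ℝ E₁ = m₁)
    (hm₂ : Module.finrank ℝ E₂ = m₂) (hS₁ : ∀ c ∈ S₁, IsCell K₁ m₁ c)
    (hS₂ : ∀ c ∈ S₂, IsCell K₂ m₂ c) {f₁ : V₁ → E₁} {f₂ : V₂ → E₂} (hf₁ : InGeneralPosition f₁)
    (hf₂ : InGeneralPosition f₂) {ε : ℝ} (hε : 0 < ε) :
    ∃ (g₁ : V₁ → ℝ) (g₂ : V₂ → ℝ), (∀ v, |g₁ v - 1| < ε) ∧ (∀ w, |g₂ w - 1| < ε) ∧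
      InGeneralPosition (withHeight f₁ g₁) ∧ InGeneralPosition (withHeight f₂ g₂) ∧
      (∀ σ τ, s(σ, τ) ∈ joinCycle S₁ S₂ →
        ∃ a, IsCircuit (linearJoin (withHeight f₁ g₁) (withHeight f₂ g₂)) (σ ∪ τ) a) ∧
      intersectionCount (linearJoin (withHeight f₁ g₁) (withHeight f₂ g₂)) (joinCycle S₁ S₂) =
        intersectionCount f₁ S₁ * intersectionCount f₂ S₂ := by
  obtain ⟨g₁, hε₁, hgp₁, H₁⟩ := hf₁.exists_heights hε
  obtain ⟨g₂, hε₂, hgp₂, H₂⟩ := hf₂.exists_heights hε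
  refine ⟨g₁, g₂, hε₁, hε₂, hgp₁, hgp₂, fun A B hAB => ?_, ?_⟩
  · obtain ⟨hl, hr⟩ := mem_joinCycle.1 hAB
    obtain ⟨hne, -, hd₁, hc₁⟩ := isCell_iff.1 (hS₁ _ hl)
    obtain ⟨-, -, hd₂, hc₂⟩ := isCell_iff.1 (hS₂ _ hr)
    obtain ⟨-, l₁, -, hl₁, hs₁, -⟩ := H₁ _ ((Finset.card_union_of_disjoint hd₁).trans (hm₁ ▸ hc₁))
    obtain ⟨-, l₂, -, hl₂, hs₂, -⟩ := H₂ _ ((Finset.card_union_of_disjoint hd₂).trans (hm₂ ▸ hc₂))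
    have := hl₁.isCircuit_linearJoin hl₂ hs₁ hs₂
      ((nonempty_of_mem_faces hne).mono Finset.subset_union_left)
    have hu : (A.toLeft ∪ B.toLeft).disjSum (A.toRight ∪ B.toRight) = A ∪ B := by
      ext (i | i) <;> simp
    rw [hu] at this
    exact ⟨_, this⟩
  · unfold intersectionCount
    rw [sum_joinCycle, Finset.sum_mul_sum]
    refine Finset.sum_congr rfl fun p hp => Finset.sum_congr rfl fun q hq => ?_
    induction p using Sym2.ind with
    | _ σ₁ τ₁ =>
    induction q using Sym2.ind with
    | _ σ₂ τ₂ =>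
    obtain ⟨hne₁, -, hd₁, hc₁⟩ := isCell_iff.1 (hS₁ _ hp)
    obtain ⟨hne₂, -, hd₂, hc₂⟩ := isCell_iff.1 (hS₂ _ hq)
    obtain ⟨a₁, l₁, ha₁, hl₁, hs₁, hsign₁⟩ :=
      H₁ _ ((Finset.card_union_of_disjoint hd₁).trans (hm₁ ▸ hc₁))
    obtain ⟨a₂, l₂, ha₂, hl₂, hs₂, hsign₂⟩ :=
      H₂ _ ((Finset.card_union_of_disjoint hd₂).trans (hm₂ ▸ hc₂))
    have hne₁ := nonempty_of_mem_faces hne₁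
    rw [sum_joinPairs (hS₁ _ hp) (hS₂ _ hq)]
    exact pairCount_add_pairCount_eq_mul hs₂ (neg_ne_zero.2 hs₁) ha₁ ha₂
      (hl₁.isCircuit_linearJoin hl₂ hs₁ hs₂ (hne₁.mono Finset.subset_union_left)) hsign₁ hsign₂
      hd₁ hd₂ hne₁ (nonempty_of_mem_faces hne₂)

/-- The linear join sends all vertices of `K₁` into a subspace of dimension `m₁ + 1`, so it can fail
to be in general position; it is perturbed, then transported to Euclidean space. -/
theorem exists_inGeneralPosition_join (hm₁ : Module.finrank ℝ E₁ = m₁)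
    (hm₂ : Module.finrank ℝ E₂ = m₂) (hS₁ : ∀ c ∈ S₁, IsCell K₁ m₁ c)
    (hS₂ : ∀ c ∈ S₂, IsCell K₂ m₂ c) {f₁ : V₁ → E₁} {f₂ : V₂ → E₂} (hf₁ : InGeneralPosition f₁)
    (hf₂ : InGeneralPosition f₂) :
    ∃ F : V₁ ⊕ V₂ → EuclideanSpace ℝ (Fin (m₁ + m₂ + 2)), InGeneralPosition F ∧
      intersectionCount F (joinCycle S₁ S₂) =
        intersectionCount f₁ S₁ * intersectionCount f₂ S₂ := by
  obtain ⟨g₁, g₂, -, -, -, -, hcirc, hcount⟩ :=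
    exists_heights_linearJoin hm₁ hm₂ hS₁ hS₂ hf₁ hf₂ one_pos
  have hfin : Module.finrank ℝ ((E₁ × ℝ) × (E₂ × ℝ)) = m₁ + m₂ + 2 := by
    simp only [Module.finrank_prod, Module.finrank_self, hm₁, hm₂]
    omega
  obtain ⟨F, hF, hFcount⟩ := exists_inGeneralPosition_intersectionCount_eq
    (G := linearJoin (withHeight f₁ g₁) (withHeight f₂ g₂)) (S := joinCycle S₁ S₂)
    fun σ τ h => by
      obtain ⟨-, -, hd, hcard⟩ := isCell_iff.1 (isCell_joinCycle hS₁ hS₂ _ h)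
      exact ⟨hd, hcard.trans (by rw [hfin]), hcirc σ τ h⟩
  let e : ((E₁ × ℝ) × (E₂ × ℝ)) ≃ₗ[ℝ] EuclideanSpace ℝ (Fin (m₁ + m₂ + 2)) :=
    LinearEquiv.ofFinrankEq _ _ (by rw [hfin, finrank_euclideanSpace_fin])
  exact ⟨_, hF.comp_linearEquiv e, by
    rw [intersectionCount_comp_linearEquiv, hFcount, hcount]⟩

theorem isObstructorCycle_joinCycle (hS₁ : IsObstructorCycle K₁ m₁ S₁)
    (hS₂ : IsObstructorCycle K₂ m₂ S₂) :
    IsObstructorCycle (join K₁ K₂) (m₁ + m₂ + 2) (joinCycle S₁ S₂) where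
  isCycle := isCycle_joinCycle hS₁ hS₂
  odd_count := by
    obtain ⟨f₁, hf₁, hodd₁⟩ := hS₁.odd_count
    obtain ⟨f₂, hf₂, hodd₂⟩ := hS₂.odd_count
    obtain ⟨F, hF, hcount⟩ := exists_inGeneralPosition_join finrank_euclideanSpace_fin
      finrank_euclideanSpace_fin hS₁.isCycle.1 hS₂.isCycle.1 hf₁ hf₂
    exact ⟨F, hF, hcount ▸ hodd₁.mul hodd₂⟩
  even_vertices σ _ _ := even_vertices_joinCycle hS₁.isCycle.1 hS₂.isCycle.1 σ

end Join
end Obstructor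
theorem mainTheorem7 {V₁ V₂ : Type*} [Finite V₁] [Finite V₂] [DecidableEq V₁] [DecidableEq V₂]
    (K₁ : AbstractSimplicialComplex V₁) (K₂ : AbstractSimplicialComplex V₂) (m₁ m₂ : ℕ)
    (h₁ : IsObstructorComplex K₁ m₁) (h₂ : IsObstructorComplex K₂ m₂) :
    IsObstructorComplex (join K₁ K₂) (m₁ + m₂ + 2) ∧
    ∀ (S₁ : Finset (Sym2 (Finset V₁))) (S₂ : Finset (Sym2 (Finset V₂))),
      IsObstructorCycle K₁ m₁ S₁ → IsObstructorCycle K₂ m₂ S₂ →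
      IsObstructorCycle (join K₁ K₂) (m₁ + m₂ + 2) (joinCycle S₁ S₂) ∧
      (joinCycle S₁ S₂).card = 2 * S₁.card * S₂.card ∧
      ∀ (f₁ : V₁ → EuclideanSpace ℝ (Fin m₁)) (f₂ : V₂ → EuclideanSpace ℝ (Fin m₂)),
        InGeneralPosition f₁ → InGeneralPosition f₂ →
        (∀ ε : ℝ, 0 < ε → ∃ (g₁ : V₁ → ℝ) (g₂ : V₂ → ℝ)
            (G : V₁ ⊕ V₂ → (EuclideanSpace ℝ (Fin m₁) × ℝ) × (EuclideanSpace ℝ (Fin m₂) × ℝ)),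
          (∀ v, |g₁ v - 1| < ε) ∧ (∀ w, |g₂ w - 1| < ε) ∧
          InGeneralPosition (withHeight f₁ g₁) ∧ InGeneralPosition (withHeight f₂ g₂) ∧
          G = linearJoin (withHeight f₁ g₁) (withHeight f₂ g₂) ∧
          (∀ σ τ, s(σ, τ) ∈ joinCycle S₁ S₂ → (simplexImage G σ ∩ simplexImage G τ).Finite) ∧
          intersectionCount G (joinCycle S₁ S₂) =
            intersectionCount f₁ S₁ * intersectionCount f₂ S₂) ∧
        (∀ F : V₁ ⊕ V₂ → EuclideanSpace ℝ (Fin (m₁ + m₂ + 2)), InGeneralPosition F →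
          intersectionCount F (joinCycle S₁ S₂) ≡
            intersectionCount f₁ S₁ * intersectionCount f₂ S₂ [MOD 2]) := by
  refine ⟨⟨fun σ hσ => simplexDim_join_le h₁.1 h₂.1 hσ, ?_⟩, fun S₁ S₂ hS₁ hS₂ =>
    ⟨isObstructorCycle_joinCycle hS₁ hS₂, card_joinCycle hS₁.isCycle.1 hS₂.isCycle.1,
      fun f₁ f₂ hf₁ hf₂ => ⟨fun ε hε => ?_, fun F hF => ?_⟩⟩⟩
  · obtain ⟨S₁, hS₁⟩ := h₁.2
    obtain ⟨S₂, hS₂⟩ := h₂.2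
    exact ⟨_, isObstructorCycle_joinCycle hS₁ hS₂⟩
  · obtain ⟨g₁, g₂, hε₁, hε₂, hgp₁, hgp₂, hcirc, hcount⟩ :=
      exists_heights_linearJoin finrank_euclideanSpace_fin finrank_euclideanSpace_fin
        hS₁.isCycle.1 hS₂.isCycle.1 hf₁ hf₂ hε
    refine ⟨g₁, g₂, _, hε₁, hε₂, hgp₁, hgp₂, rfl, fun σ τ h => ?_, hcount⟩
    obtain ⟨a, ha⟩ := hcirc σ τ h
    exact (ha.inter_subsingleton subset_rfl
      (isCell_iff.1 (isCell_joinCycle hS₁.isCycle.1 hS₂.isCycle.1 _ h)).2.2.1).finite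
  · obtain ⟨F', hF', hcount⟩ := exists_inGeneralPosition_join finrank_euclideanSpace_fin
      finrank_euclideanSpace_fin hS₁.isCycle.1 hS₂.isCycle.1 hf₁ hf₂
    -- The product is replaced by the count of a general position map `F'` that realises it exactly,
    -- so that invariance of the parity applies.
    rw [← hcount]
    exact (isCycle_joinCycle hS₁ hS₂).intersectionCount_modEq finrank_euclideanSpace_fin hF hF'
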